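/- **Setting.** Let $\mathcal P=\{\nu_\theta:\theta\in\Theta\}$, $\Theta\subset\mathbb R$, be a one-parameter canonical exponential family: $\nu_\theta$ has density $e^{x\theta-b(\theta)}$ with respect to a reference measure $m$ on $\mathbb R$, where $b:\Theta\to\mathbb R$ is strictly convex and twice differentiable. Let $\mathcal I=\dot b(\Theta)$ be the set of mean parameters, let $\nu^\mu$ be the member of $\mathcal P$ with mean $\mu\in\mathcal I$, and let $d(\mu,\mu')=\mathrm{KL}(\nu^\mu,\nu^{\mu'})$. Let $\mathcal O_1,\dots,\mathcal O_M\subset\mathcal I^K$ be pairwise disjoint open subsets of $\mathbb R^K$, let $\mathcal O=\bigcup_i\mathcal O_i$, and for $\mu\in\mathbb R^K$ let $\mathrm{Alt}(\mu)=\bigcup_{i:\mu\notin\mathcal O_i}\mathcal O_i$. In the bandit model $\mu\in\mathcal I^K$, at each round $t\ge 1$ a sampling rule selects an arm $A_t\in\{1,\dots,K\}$ on the basis of the past arms and observations (and possibly an independent randomization), and then $X_t\sim\nu^{\mu_{A_t}}$ is observed. Let $N_a(t)$ be the number of selections of arm $a$ in the first $t$ rounds, and $\hat\mu(t)$ the vector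 of empirical means, which is defined once every $N_a(t)>0$. If $\hat\mu(t)$ is defined and belongs to $\mathcal O$, let $\hat\imath(t)$ be the index with $\hat\mu(t)\in\mathcal O_{\hat\imath(t)}$. With $\Sigma_K$ the probability simplex, let $$T^*(\mu)^{-1}=\sup_{w\in\Sigma_K}\inf_{\lambda\in\mathrm{Alt}(\mu)}\sum_{a=1}^K w_a d(\mu_a,\lambda_a)$$ (with $\inf\emptyset=+\infty$ and $1/{+\infty}=0$), and let $w^*(\mu)$ be the maximizer $w$ when it exists and is unique. *Tracking rule.* Let $\mathcal U_t=\{a: N_a(t)\le\max(\sqrt t-K/2,0)\}$. At time $t+1$ the rule selects $A_{t+1}\in\operatorname{argmin}_{a\in\mathcal U_t}N_a(t)$ if $\mathcal U_t\ne\emptyset$, and otherwise $A_{t+1}\in\operatorname{argmax}_{a}\,\bigl(t\,w^*_a(\hat\mu(t))-N_a(t)\bigr)$; ties are broken arbitrarily, and an arbitrary arm may be selected if $\mathcal U_t=\emptyset$ and $\hat\mu(t)\notin\mathcal O$. *Extended GLR stopping rule.* Let $\hat\Lambda_t=\inf_{\lambda\in\mathrm{Alt}(\hat\mu(t))}\sum_{a}N_a(t)\,d(\hat\mu_a(t),\lambda_a)$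 if $\hat\mu(t)$ is defined and belongs to $\mathcal O$, and $\hat\Lambda_t=0$ otherwise. Given thresholds $\hat c_t(\delta)\in\mathbb R$, let $\tau_\delta=\inf\{t\in\mathbb N:\hat\Lambda_t>\hat c_t(\delta)\}$. **Theorem.** Assume that for every $\mu\in\mathcal O$ there is a unique vector of optimal weights $w^*(\mu)$, and that $\mu\mapsto w^*(\mu)$ is continuous on each $\mathcal O_i$. Let $(\hat c_t(\delta))_{t\in\mathbb N}$, $\delta\in(0,1]$, be deterministic thresholds that are nondecreasing in $t$ and for which there are constants $C,D>0$ with $$\hat c_t(\delta)\le\ln\Bigl(\frac{Dt}{\delta}\Bigr)\qquad\text{for all } t\ge C \text{ and all } \delta\in(0,1].$$ Then, under any Tracking rule, for every $\mu\in\mathcal O$, $$\limsup_{\delta\to0}\frac{\mathbb E_\mu[\tau_\delta]}{\ln(1/\delta)}\le T^*(\mu).$$ If moreover the resulting strategy is $\delta$-correct for every $\delta\in(0,1]$, that is, for every $\mu'\in\mathcal O$ the probability under $\mu'$ that $\tau_\delta<\infty$ and $\mu'\notin\mathcal O_{\hat\imath(\tau_\delta)}$ is at most $\delta$ (stopping at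 a time when $\hat\imath$ is undefined counts as an error), then for every $\mu\in\mathcal O$ $$\limsup_{\delta\to0}\frac{\mathbb E_\mu[\tau_\delta]}{\ln(1/\delta)}=T^*(\mu).$$ -/

import Mathlib

open MeasureTheory ProbabilityTheory Filter Topology Set
open scoped ENNReal NNReal

noncomputable section

/-- A one-parameter canonical exponential family on `ℝ`: natural parameters `Θ`, log-partition
function `b` (strictly convex and twice differentiable on `Θ`; derivatives are taken within `Θ`,
so `Θ` need not be open), and a reference measure `m` such that `x ↦ exp (x θ - b θ)` is a
probability density with respect to `m` for every `θ ∈ Θ`. -/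
structure ExpFamily where
  Θ : Set ℝ
  b : ℝ → ℝ
  m : Measure ℝ
  strictConvex : StrictConvexOn ℝ Θ b
  differentiable : DifferentiableOn ℝ b Θ
  twiceDifferentiable : DifferentiableOn ℝ (derivWithin b Θ) Θ
  normalized : ∀ θ ∈ Θ, ∫⁻ x, ENNReal.ofReal (Real.exp (x * θ - b θ)) ∂m = 1

namespace ExpFamily

variable (F : ExpFamily)

/-- The set `𝓘 = b'(Θ)` of mean parameters. -/
def means : Set ℝ := derivWithin F.b F.Θ '' F.Θ

/-- The natural parameter `b'⁻¹(μ)` of a mean `μ ∈ 𝓘`. -/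
def natParam (μ : ℝ) : ℝ := Function.invFunOn (derivWithin F.b F.Θ) F.Θ μ

open Classical in
/-- The member `ν^μ` of the family with mean `μ ∈ 𝓘`. Outside `𝓘` the value is an irrelevant
probability measure. -/
def dist (μ : ℝ) : Measure ℝ :=
  if μ ∈ F.means then
    F.m.withDensity fun x => ENNReal.ofReal (Real.exp (x * F.natParam μ - F.b (F.natParam μ)))
  else Measure.dirac 0

instance isProbabilityMeasure_dist (μ : ℝ) : IsProbabilityMeasure (F.dist μ) := by
  unfold dist
  split_ifs with h
  · refine ⟨?_⟩
    rw [withDensity_apply _ MeasurableSet.univ, Measure.restrict_univ]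
    exact F.normalized _ (Function.invFunOn_mem h)
  · infer_instance

/-- The divergence `d(μ, μ') = KL(ν^μ, ν^μ')`. -/
def d (μ μ' : ℝ) : ℝ≥0∞ := InformationTheory.klDiv (F.dist μ) (F.dist μ')

end ExpFamily

/-! ### The interaction between a sampling rule and a bandit model

A trajectory is `ω : ℕ → Fin K × ℝ`, where `ω s = (A_{s+1}, X_{s+1})` holds the arm selected at
round `s + 1` and the observation received at that round. -/

/-- A (randomized) sampling rule: the law of the first arm, and, for every `n`, the conditional law
of the arm of round `n + 2` given the arms and the observations of rounds `1, …, n + 1`. -/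
structure SamplingRule (K : ℕ) where
  first : Measure (Fin K)
  next : (n : ℕ) → Kernel ((i : Finset.Iic n) → Fin K × ℝ) (Fin K)
  isProbabilityMeasure_first : IsProbabilityMeasure first
  isMarkovKernel_next : ∀ n, IsMarkovKernel (next n)

attribute [instance] SamplingRule.isProbabilityMeasure_first SamplingRule.isMarkovKernel_next

/-- The kernel giving the law of an observation from each arm. -/
def armKernel {K : ℕ} (ν : Fin K → Measure ℝ) : Kernel (Fin K) ℝ where
  toFun := ν
  measurable' := Measurable.of_discrete

instance isMarkovKernel_armKernel {K : ℕ} (ν : Fin K → Measure ℝ)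
    [h : ∀ a, IsProbabilityMeasure (ν a)] : IsMarkovKernel (armKernel ν) := ⟨h⟩

/-- The law of the trajectory when the sampling rule `π` interacts with the arms `ν`: at each round
an arm `a` is drawn by `π` given the past, and then, given the past and `a`, an observation is drawn
from `ν a`. -/
def SamplingRule.law {K : ℕ} (π : SamplingRule K) (ν : Fin K → Measure ℝ)
    [∀ a, IsProbabilityMeasure (ν a)] : Measure (ℕ → Fin K × ℝ) :=
  Kernel.trajMeasure (X := fun _ => Fin K × ℝ) (π.first ⊗ₘ armKernel ν)
    fun n => π.next n ⊗ₖ Kernel.prodMkLeft _ (armKernel ν)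

/-- The number `N_a(t)` of selections of the arm `a` in the first `t` rounds. -/
def pulls {K : ℕ} (ω : ℕ → Fin K × ℝ) (a : Fin K) (t : ℕ) : ℕ :=
  ((Finset.range t).filter fun s => (ω s).1 = a).card

/-- The vector `μ̂(t)` of empirical means after `t` rounds (its coordinate `a` is meaningful once
`N_a(t) ≠ 0`). -/
def empMean {K : ℕ} (ω : ℕ → Fin K × ℝ) (t : ℕ) (a : Fin K) : ℝ :=
  (∑ s ∈ (Finset.range t).filter (fun s => (ω s).1 = a), (ω s).2) / (pulls ω a t : ℝ)

/-- A sequential identification problem with `K` arms in the family `F`: pairwise disjoint open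
sets `𝓞_1, …, 𝓞_M` of vectors of mean parameters. -/
structure IdentificationProblem (F : ExpFamily) (K M : ℕ) where
  cell : Fin M → Set (Fin K → ℝ)
  isOpen_cell : ∀ i, IsOpen (cell i)
  disjoint_cell : Pairwise fun i j => Disjoint (cell i) (cell j)
  cell_subset : ∀ i, ∀ μ ∈ cell i, ∀ a, μ a ∈ F.means

namespace IdentificationProblem

variable {F : ExpFamily} {K M : ℕ} (P : IdentificationProblem F K M)

/-- The set `𝓞` of possible means, the union of the cells. -/
def domain : Set (Fin K → ℝ) := ⋃ i, P.cell i

/-- `Alt(μ)`, the union of the cells that do not contain `μ`. -/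
def alt (μ : Fin K → ℝ) : Set (Fin K → ℝ) := ⋃ i, ⋃ _ : μ ∉ P.cell i, P.cell i

/-- `inf_{λ ∈ Alt(μ)} ∑_a w_a d(μ_a, λ_a)`, with the value `∞` if `Alt(μ)` is empty. -/
def value (μ w : Fin K → ℝ) : ℝ≥0∞ :=
  ⨅ lam ∈ P.alt μ, ∑ a, ENNReal.ofReal (w a) * F.d (μ a) (lam a)

/-- The complexity `T*(μ)`, the inverse of `sup_{w ∈ Σ_K} inf_{λ ∈ Alt(μ)} ∑_a w_a d(μ_a, λ_a)`. -/
def complexity (μ : Fin K → ℝ) : ℝ≥0∞ := (⨆ w ∈ stdSimplex ℝ (Fin K), P.value μ w)⁻¹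

/-- `w` belongs to the argmax over the simplex that defines the optimal weights at `μ`. -/
def IsOptimalWeights (μ w : Fin K → ℝ) : Prop :=
  w ∈ stdSimplex ℝ (Fin K) ∧ ∀ w' ∈ stdSimplex ℝ (Fin K), P.value μ w' ≤ P.value μ w

/-- The optimal weights `w*(μ)`: the element of the argmax when it exists and is unique. -/
def optWeights (μ : Fin K → ℝ) : Fin K → ℝ := Classical.epsilon (P.IsOptimalWeights μ)

/-- The set `𝒰_t` of under-sampled arms. -/
def underSampled (ω : ℕ → Fin K × ℝ) (t : ℕ) : Set (Fin K) :=
  {a | (pulls ω a t : ℝ) ≤ max (√(t : ℝ) - K / 2) 0}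

open Classical in
/-- The arms that the Tracking rule may select at round `t + 1`: a least sampled arm of `𝒰_t` if
`𝒰_t` is not empty, otherwise a maximizer of `t w*_a(μ̂(t)) - N_a(t)` (ties are broken arbitrarily).
If `𝒰_t` is empty and `μ̂(t) ∉ 𝓞`, where `w*(μ̂(t))` is undefined, any arm may be selected.
If `𝒰_t` is empty, then every arm has been sampled, so that `μ̂(t)` is well defined. -/
def trackingArms (ω : ℕ → Fin K × ℝ) (t : ℕ) : Set (Fin K) :=
  if (underSampled ω t).Nonempty then
    {a ∈ underSampled ω t | ∀ a' ∈ underSampled ω t, pulls ω a t ≤ pulls ω a' t}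
  else if empMean ω t ∈ P.domain then
    {a | ∀ a', (t : ℝ) * P.optWeights (empMean ω t) a' - pulls ω a' t ≤
      (t : ℝ) * P.optWeights (empMean ω t) a - pulls ω a t}
  else univ

/-- `π` is a Tracking rule: after every history it only selects arms of `trackingArms`
(which depends on `ω` only through the first `t` rounds). -/
def IsTracking (π : SamplingRule K) : Prop :=
  (∀ ω, π.first (P.trackingArms ω 0)ᶜ = 0) ∧
  ∀ (n : ℕ) (ω : ℕ → Fin K × ℝ),
    π.next n (Preorder.frestrictLe (π := fun _ => Fin K × ℝ) n ω) (P.trackingArms ω (n + 1))ᶜ = 0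

/-- `î(t) = i`: the empirical means after `t` rounds are well defined and lie in the cell `i`. -/
def Recommends (ω : ℕ → Fin K × ℝ) (t : ℕ) (i : Fin M) : Prop :=
  (∀ a, pulls ω a t ≠ 0) ∧ empMean ω t ∈ P.cell i

open Classical in
/-- The extended GLR statistic `Λ̂_t = inf_{λ ∈ Alt(μ̂(t))} ∑_a N_a(t) d(μ̂_a(t), λ_a)`,
with `Λ̂_t = 0` as long as `μ̂(t)` is undefined or is not in `𝓞`. -/
def glr (ω : ℕ → Fin K × ℝ) (t : ℕ) : ℝ≥0∞ :=
  if ∃ i, P.Recommends ω t i then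
    ⨅ lam ∈ P.alt (empMean ω t), ∑ a, (pulls ω a t : ℝ≥0∞) * F.d (empMean ω t a) (lam a)
  else 0

/-- The extended GLR stopping rule `τ = inf {t | Λ̂_t > c_t}`, equal to `∞` if there is no such `t`.
The thresholds are real and the statistic may be `∞`, so they are compared in `EReal`. -/
def stoppingTime (c : ℕ → ℝ) (ω : ℕ → Fin K × ℝ) : ℕ∞ :=
  ⨅ t ∈ {t : ℕ | ((c t : ℝ) : EReal) < ((P.glr ω t : ℝ≥0∞) : EReal)}, (t : ℕ∞)

/-- The law `ℙ_μ` of the trajectory under the sampling rule `π`, in the bandit model `μ`. -/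
def law (_P : IdentificationProblem F K M) (π : SamplingRule K) (μ : Fin K → ℝ) :
    Measure (ℕ → Fin K × ℝ) :=
  π.law fun a => F.dist (μ a)

/-- The expected sample complexity `𝔼_μ[τ]`. -/
def expectedTime (π : SamplingRule K) (c : ℕ → ℝ) (μ : Fin K → ℝ) : ℝ≥0∞ :=
  ∫⁻ ω, (P.stoppingTime c ω : ℝ≥0∞) ∂(P.law π μ)

/-- `δ`-correctness: for every `μ ∈ 𝓞`, the probability under `μ` to stop without recommending the
cell of `μ` is at most `δ`. -/
def IsCorrect (π : SamplingRule K) (c : ℕ → ℝ) (δ : ℝ) : Prop :=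
  ∀ i, ∀ μ ∈ P.cell i,
    P.law π μ {ω | ∃ t : ℕ, P.stoppingTime c ω = t ∧ ¬ P.Recommends ω t i} ≤ ENNReal.ofReal δ

end IdentificationProblem

end

/-! The two bounds are proved separately. Both rest on the closed form `bregman` of the divergence
and on changes of measure between bandit models, in which the arm probabilities of the sampling rule
cancel and only the observation densities remain.

Upper bound. Forced exploration gives every arm at least `√t - K - 1` pulls on each trajectory that
obeys the rule (`sqrt_sub_le_pulls`). A Chernoff bound, obtained by tilting a single arm, then makes
the probability that an empirical mean is off by a fixed amount at time `t` of order `exp (-κ √t)`.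
Hence the last exit time of the empirical means from a neighborhood of `μ` is dominated by a
variable `σ` with finite expectation (`exists_last_exit_bound`). After that exit, continuity of the
optimal weights keeps the targets close to `w*(μ)`, the sampling proportions follow
(`mul_sub_le_pulls`), and the GLR statistic is at least `t v`, for any fixed `v` below the optimal
value, after a delay that is linear in the exit time (`exists_glr_ge`). The threshold is at most
`log (1/δ) + log (D t)`, so stopping occurs within an integrable delay plus about `log (1/δ) / u`,
for any `u < v`. Integrating and letting `u` increase to the optimal value gives `T*(μ)`.

The neighborhood must work for all alternatives at once, although `Alt(μ)` need not be compact. This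
is `eventually_bregman_ge`: the divergence grows at least linearly in the natural parameter of its
second argument, which absorbs the effect of moving the first.

Lower bound. Correctness makes the event of stopping with the cell of `μ` have probability at most
`δ` under every alternative. A change of measure at the truncated stopping time and Wald's identity
turn this into a lower bound on the expected log-likelihood ratio, which is a combination of
divergences weighted by expected pulls (`log_mul_sub_le`). Normalizing these weights gives a point
of the simplex, and comparison with the supremum that defines `T*(μ)` bounds the expected time from
below. -/

noncomputable section

/-! ### Exponential families: natural parameters, divergence, densities and means -/

namespace ExpFamily

variable (F : ExpFamily) {x y : ℝ}

lemma natParam_mem (hx : x ∈ F.means) : F.natParam x ∈ F.Θ :=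
  Function.invFunOn_mem hx

lemma derivWithin_natParam (hx : x ∈ F.means) : derivWithin F.b F.Θ (F.natParam x) = x :=
  Function.invFunOn_eq hx

lemma strictMonoOn_derivWithin : StrictMonoOn (derivWithin F.b F.Θ) F.Θ :=
  F.strictConvex.strictMonoOn_derivWithin F.differentiable

lemma natParam_derivWithin {θ : ℝ} (hθ : θ ∈ F.Θ) : F.natParam (derivWithin F.b F.Θ θ) = θ :=
  F.strictMonoOn_derivWithin.injOn (F.natParam_mem (mem_image_of_mem _ hθ)) hθ
    (F.derivWithin_natParam (mem_image_of_mem _ hθ))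

lemma strictMonoOn_natParam : StrictMonoOn F.natParam F.means := by
  intro x hx y hy hxy
  by_contra! h
  have := F.strictMonoOn_derivWithin.monotoneOn (F.natParam_mem hy) (F.natParam_mem hx) h
  rw [F.derivWithin_natParam hx, F.derivWithin_natParam hy] at this
  linarith

lemma tangent_lt (hx : x ∈ F.means) {θ : ℝ} (hθ : θ ∈ F.Θ) (h : θ ≠ F.natParam x) :
    F.b (F.natParam x) + x * (θ - F.natParam x) < F.b θ := by
  have hx' := F.natParam_mem hx
  have hd := F.derivWithin_natParam hx
  rcases lt_or_gt_of_ne h with h | h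
  · have := F.strictConvex.slope_lt_derivWithin hθ hx' h (F.differentiable _ hx')
    rw [hd, slope_def_field, div_lt_iff₀ (by linarith)] at this
    linarith
  · have := F.strictConvex.lt_slope_of_hasDerivWithinAt hx' hθ h
      (F.differentiable _ hx').hasDerivWithinAt
    rw [hd, slope_def_field, lt_div_iff₀ (by linarith)] at this
    linarith

lemma tangent_le (hx : x ∈ F.means) {θ : ℝ} (hθ : θ ∈ F.Θ) :
    F.b (F.natParam x) + x * (θ - F.natParam x) ≤ F.b θ := by
  rcases eq_or_ne θ (F.natParam x) with rfl | h
  · simp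
  · exact (F.tangent_lt hx hθ h).le

/-- The closed form of the divergence `d x y`. -/
def bregman (x y : ℝ) : ℝ :=
  (F.natParam x - F.natParam y) * x - F.b (F.natParam x) + F.b (F.natParam y)

lemma bregman_nonneg (hx : x ∈ F.means) (hy : y ∈ F.means) : 0 ≤ F.bregman x y := by
  have := F.tangent_le hx (F.natParam_mem hy)
  unfold bregman
  linarith

lemma bregman_pos (hx : x ∈ F.means) (hy : y ∈ F.means) (h : x ≠ y) : 0 < F.bregman x y := by
  have := F.tangent_lt hx (F.natParam_mem hy)
    (fun h' => h (F.strictMonoOn_natParam.injOn hy hx h').symm)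
  unfold bregman
  linarith

lemma exists_mem_means_of_mem_interior (hx : x ∈ interior F.means) :
    ∃ ε > 0, x + ε ∈ F.means ∧ x - ε ∈ F.means := by
  obtain ⟨ε, hε, h⟩ := Metric.mem_nhds_iff.1 (mem_interior_iff_mem_nhds.1 hx)
  refine ⟨ε / 2, by positivity, h ?_, h ?_⟩ <;>
    simp [abs_of_pos, hε]

/-- `Θ` is an interval, and the natural parameters of `x - ε` and `x + ε` lie in it on either side
of that of `x`. -/
lemma natParam_mem_interior (hx : x ∈ interior F.means) : F.natParam x ∈ interior F.Θ := by
  obtain ⟨ε, hε, h1, h2⟩ := F.exists_mem_means_of_mem_interior hx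
  have hx' := interior_subset hx
  rw [mem_interior_iff_mem_nhds]
  refine mem_of_superset (Icc_mem_nhds (F.strictMonoOn_natParam h2 hx' (by linarith))
    (F.strictMonoOn_natParam hx' h1 (by linarith))) ?_
  exact F.strictConvex.1.ordConnected.out (F.natParam_mem h2) (F.natParam_mem h1)

/-- A monotone function has no jump where its image fills a neighborhood, and here the image is all
of `Θ`. -/
lemma continuousAt_natParam (hx : x ∈ interior F.means) : ContinuousAt F.natParam x := by
  refine continuousAt_of_monotoneOn_of_image_mem_nhds F.strictMonoOn_natParam.monotoneOn
    (mem_interior_iff_mem_nhds.1 hx) ?_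
  refine mem_of_superset (mem_interior_iff_mem_nhds.1 (F.natParam_mem_interior hx)) ?_
  intro θ hθ
  exact ⟨_, mem_image_of_mem _ hθ, F.natParam_derivWithin hθ⟩

lemma continuousAt_b {θ : ℝ} (h : θ ∈ interior F.Θ) : ContinuousAt F.b θ :=
  (F.differentiable.differentiableAt (mem_interior_iff_mem_nhds.1 h)).continuousAt

lemma continuousAt_bregman (hx : x ∈ interior F.means) (y : ℝ) :
    ContinuousAt (fun x => F.bregman x y) x := by
  have h1 := F.continuousAt_natParam hx
  have h2 : ContinuousAt (fun x => F.b (F.natParam x)) x :=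
    ContinuousAt.comp (F.continuousAt_b (F.natParam_mem_interior hx)) h1
  unfold bregman
  exact (((h1.sub continuousAt_const).mul continuousAt_id).sub h2).add continuousAt_const

/-- A lower bound on `bregman x' y` for `x'` close to `x`, uniform in `y`. -/
lemma eventually_bregman_ge (hx : x ∈ interior F.means) {κ : ℝ} (hκ : 0 < κ) :
    ∀ᶠ x' in 𝓝 x, ∀ y ∈ F.means, (1 - κ) * F.bregman x y - κ ≤ F.bregman x' y := by
  obtain ⟨ε, hε, hp, hm⟩ := F.exists_mem_means_of_mem_interior hx
  have hxm := interior_subset hx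
  set θ := F.natParam x with hθ
  set θp := F.natParam (x + ε) with hθp
  set θm := F.natParam (x - ε) with hθm
  have hmθ : θm < θ := F.strictMonoOn_natParam hm hxm (by linarith)
  have hpθ : θ < θp := F.strictMonoOn_natParam hxm hp (by linarith)
  set r := θp - θm with hr
  have hr0 : 0 < r := by linarith
  have h1 := F.continuousAt_natParam hx
  have h2 : ContinuousAt (fun x => F.b (F.natParam x)) x :=
    ContinuousAt.comp (F.continuousAt_b (F.natParam_mem_interior hx)) h1
  have hcont : ContinuousAt (fun x' => F.natParam x' * x' - F.b (F.natParam x') - θ * x'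
      + F.b θ) x :=
    (((h1.mul continuousAt_id).sub h2).sub (continuousAt_const.mul continuousAt_id)).add
      continuousAt_const
  have e1 : ∀ᶠ x' in 𝓝 x, F.natParam x' * x' - F.b (F.natParam x') - θ * x' + F.b θ > -(κ / 2) := by
    refine hcont.eventually (lt_mem_nhds ?_)
    simp only [← hθ]
    linarith
  have e2 : ∀ᶠ x' in 𝓝 x, |x' - x| < min (κ * ε) (κ / (2 * r)) := by
    have : ContinuousAt (fun x' => |x' - x|) x := by fun_prop
    refine this.eventually (gt_mem_nhds ?_)
    simp only [sub_self, abs_zero]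
    positivity
  filter_upwards [e1, e2] with x' hx1 hx2 y hy
  have hy' := F.natParam_mem hy
  set η := F.natParam y with hη
  have a1 := F.tangent_le hp hy'
  have a2 := F.tangent_le hxm (F.natParam_mem hp)
  have b1 := F.tangent_le hm hy'
  have b2 := F.tangent_le hxm (F.natParam_mem hm)
  have d0 := F.bregman_nonneg hxm hy
  -- Linear growth in `η`: add the tangent inequality at `x` to the one at `x + ε` or `x - ε`,
  -- according to the side of `θ` on which `η` lies. The slopes differ by `ε`, which is the growth
  -- rate.
  have key : ε * (|η - θ| - r) ≤ F.bregman x y := by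
    have e : F.bregman x y = (θ - η) * x - F.b θ + F.b η := rfl
    rcases le_or_gt θ η with h | h
    · rw [abs_of_nonneg (by linarith)]
      have : ε * (η - θ - r) ≤ ε * (η - θp) := by
        apply mul_le_mul_of_nonneg_left _ hε.le; linarith
      rw [e]; nlinarith
    · rw [abs_of_neg (by linarith)]
      have : ε * (-(η - θ) - r) ≤ ε * (θm - η) := by
        apply mul_le_mul_of_nonneg_left _ hε.le; linarith
      rw [e]; nlinarith
  have h3 : |x' - x| ≤ κ * ε := (hx2.trans_le (min_le_left _ _)).le
  have h4 : |x' - x| * r ≤ κ / 2 := by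
    have := (hx2.trans_le (min_le_right _ _)).le
    rw [le_div_iff₀ (by positivity)] at this
    linarith
  -- This is the only part of the change in divergence that depends on `y`. By `key` it is at most a
  -- small multiple of the divergence plus a constant: the bound `κ * ε` on `|x' - x|` controls the
  -- multiple, the bound `κ / (2 * r)` the constant.
  have h5 : |(η - θ) * (x' - x)| ≤ κ * F.bregman x y + κ / 2 := by
    rw [abs_mul]
    have h6 : |η - θ| * ε ≤ F.bregman x y + ε * r := by linarith
    have h7 : |x' - x| / ε ≤ κ := by rw [div_le_iff₀ hε]; exact h3
    calc |η - θ| * |x' - x| = (|η - θ| * ε) * (|x' - x| / ε) := by field_simp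
      _ ≤ (F.bregman x y + ε * r) * (|x' - x| / ε) := by gcongr
      _ = F.bregman x y * (|x' - x| / ε) + |x' - x| * r := by field_simp
      _ ≤ F.bregman x y * κ + κ / 2 := by gcongr
      _ = _ := by ring
  have h8 := (abs_le.1 h5).2
  have e : F.bregman x' y - F.bregman x y =
      (F.natParam x' * x' - F.b (F.natParam x') - θ * x' + F.b θ) - (η - θ) * (x' - x) := by
    simp only [bregman, ← hη, ← hθ]; ring
  linarith

/-- The log-likelihood ratio of `dist x` with respect to `dist y`. -/
def logRatio (x y z : ℝ) : ℝ :=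
  (F.natParam x - F.natParam y) * z - (F.b (F.natParam x) - F.b (F.natParam y))

lemma measurable_logRatio (x y : ℝ) : Measurable (F.logRatio x y) := by
  unfold logRatio; fun_prop

lemma logRatio_neg (x y z : ℝ) : - F.logRatio x y z = F.logRatio y x z := by
  unfold logRatio; ring

lemma logRatio_apply_mean (x y : ℝ) : F.logRatio x y x = F.bregman x y := by
  unfold logRatio bregman; ring

lemma dist_eq_withDensity (hx : x ∈ F.means) (hy : y ∈ F.means) :
    F.dist y = (F.dist x).withDensity fun z => ENNReal.ofReal (Real.exp (F.logRatio y x z)) := by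
  rw [dist, dist, if_pos hx, if_pos hy, ← withDensity_mul _ (by fun_prop)
    (by have := F.measurable_logRatio y x; fun_prop)]
  congr 1
  ext z
  rw [Pi.mul_apply, ← ENNReal.ofReal_mul (by positivity), ← Real.exp_add]
  congr 2
  unfold logRatio
  ring

lemma lintegral_exp_dist (hx : x ∈ F.means) {s : ℝ} (hs : F.natParam x + s ∈ F.Θ) :
    ∫⁻ z, ENNReal.ofReal (Real.exp (s * z)) ∂(F.dist x) =
      ENNReal.ofReal (Real.exp (F.b (F.natParam x + s) - F.b (F.natParam x))) := by
  rw [dist, if_pos hx, lintegral_withDensity_eq_lintegral_mul _ (by fun_prop) (by fun_prop)]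
  have : ∀ z, ENNReal.ofReal (Real.exp (z * F.natParam x - F.b (F.natParam x))) *
      ENNReal.ofReal (Real.exp (s * z)) =
      ENNReal.ofReal (Real.exp (F.b (F.natParam x + s) - F.b (F.natParam x))) *
      ENNReal.ofReal (Real.exp (z * (F.natParam x + s) - F.b (F.natParam x + s))) := by
    intro z
    rw [← ENNReal.ofReal_mul (by positivity), ← Real.exp_add,
      ← ENNReal.ofReal_mul (by positivity), ← Real.exp_add]
    congr 2
    ring
  simp only [Pi.mul_apply, this]
  rw [lintegral_const_mul _ (by fun_prop), F.normalized _ hs, mul_one]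

lemma integrable_exp_dist (hx : x ∈ F.means) {s : ℝ} (hs : F.natParam x + s ∈ F.Θ) :
    Integrable (fun z => Real.exp (s * z)) (F.dist x) := by
  refine ⟨by fun_prop, ?_⟩
  rw [hasFiniteIntegral_iff_ofReal (ae_of_all _ fun z => (Real.exp_pos _).le),
    F.lintegral_exp_dist hx hs]
  exact ENNReal.ofReal_lt_top

lemma eventually_natParam_add_mem (hx : x ∈ interior F.means) :
    ∀ᶠ s in 𝓝 (0 : ℝ), F.natParam x + s ∈ interior F.Θ := by
  have : ContinuousAt (fun s => F.natParam x + s) 0 := by fun_prop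
  refine this.eventually_mem ?_
  rw [add_zero]
  exact isOpen_interior.mem_nhds (F.natParam_mem_interior hx)

lemma zero_mem_interior_integrableExpSet (hx : x ∈ interior F.means) :
    0 ∈ interior (integrableExpSet (fun z : ℝ => z) (F.dist x)) := by
  rw [mem_interior_iff_mem_nhds]
  filter_upwards [F.eventually_natParam_add_mem hx] with s hs
  exact F.integrable_exp_dist (interior_subset hx) (interior_subset hs)

lemma integrable_id_dist (hx : x ∈ interior F.means) :
    Integrable (fun z : ℝ => z) (F.dist x) :=
  integrable_of_mem_interior_integrableExpSet (F.zero_mem_interior_integrableExpSet hx)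

/-- The moment generating function at `s` is `exp (b (θ + s) - b θ)` for `s` near `0`, so its
derivative at `0` is `b' θ = x`. Interiority of `x` makes the formula valid on a neighborhood of
`0`. -/
lemma integral_id_dist (hx : x ∈ interior F.means) : ∫ z, z ∂(F.dist x) = x := by
  have hxm := interior_subset hx
  rw [← deriv_mgf_zero (F.zero_mem_interior_integrableExpSet hx)]
  have h1 : mgf (fun z : ℝ => z) (F.dist x) =ᶠ[𝓝 0]
      fun s => Real.exp (F.b (F.natParam x + s) - F.b (F.natParam x)) := by
    filter_upwards [F.eventually_natParam_add_mem hx] with s hs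
    rw [mgf, integral_eq_lintegral_of_nonneg_ae (ae_of_all _ fun z => (Real.exp_pos _).le)
      (by fun_prop), F.lintegral_exp_dist hxm (interior_subset hs),
      ENNReal.toReal_ofReal (Real.exp_pos _).le]
  rw [h1.deriv_eq]
  have hθ := F.natParam_mem_interior hx
  have hnhds := mem_interior_iff_mem_nhds.1 hθ
  have h2 : HasDerivAt F.b x (F.natParam x) := by
    have := (F.differentiable.differentiableAt hnhds).hasDerivAt
    rwa [← derivWithin_of_mem_nhds hnhds, F.derivWithin_natParam hxm] at this
  have h3 : HasDerivAt (fun s => F.b (F.natParam x + s)) x 0 := by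
    have : HasDerivAt F.b x (F.natParam x + 0) := by simpa using h2
    exact this.comp_const_add _ _
  have h4 := (h3.sub_const (F.b (F.natParam x))).exp
  simpa using h4.deriv

lemma integrable_logRatio (hx : x ∈ interior F.means) (y : ℝ) :
    Integrable (F.logRatio x y) (F.dist x) := by
  unfold logRatio
  exact ((F.integrable_id_dist hx).const_mul _).sub (integrable_const _)

lemma integral_logRatio (hx : x ∈ interior F.means) (y : ℝ) :
    ∫ z, F.logRatio x y z ∂(F.dist x) = F.bregman x y := by
  unfold logRatio bregman
  rw [integral_sub ((F.integrable_id_dist hx).const_mul _) (integrable_const _),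
    integral_const_mul, F.integral_id_dist hx]
  simp
  ring

/-- The log-likelihood ratio is affine in the observation, so its mean under `dist x` is its value
at the mean `x`. -/
lemma d_eq (hx : x ∈ interior F.means) (hy : y ∈ F.means) :
    F.d x y = ENNReal.ofReal (F.bregman x y) := by
  have hxm := interior_subset hx
  have h := F.dist_eq_withDensity hy hxm
  have hac : F.dist x ≪ F.dist y := by rw [h]; exact withDensity_absolutelyContinuous _ _
  have hllr : llr (F.dist x) (F.dist y) =ᵐ[F.dist x] F.logRatio x y := by
    have : (F.dist x).rnDeriv (F.dist y) =ᵐ[F.dist y]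
        fun z => ENNReal.ofReal (Real.exp (F.logRatio x y z)) := by
      conv_lhs => rw [h]
      exact Measure.rnDeriv_withDensity _ (by have := F.measurable_logRatio x y; fun_prop)
    filter_upwards [hac.ae_le this] with z hz
    rw [llr, hz, ENNReal.toReal_ofReal (Real.exp_pos _).le, Real.log_exp]
  rw [d, InformationTheory.klDiv_of_ac_of_integrable hac
    ((F.integrable_logRatio hx y).congr hllr.symm), integral_congr_ae hllr, F.integral_logRatio hx]
  simp

end ExpFamily

/-! ### The law of a trajectory: disintegration and change of measure -/

namespace SamplingRule

variable {K : ℕ} (π : SamplingRule K)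

/-- The probability that the rule selects the arm `a` at round `t + 1` given the past. -/
def armProb (π : SamplingRule K) : ℕ → (ℕ → Fin K × ℝ) → Fin K → ℝ≥0∞
  | 0, _, a => π.first {a}
  | n + 1, ω, a => π.next n (Preorder.frestrictLe (π := fun _ => Fin K × ℝ) n ω) {a}

lemma measurable_armProb (t : ℕ) (a : Fin K) : Measurable fun ω => π.armProb t ω a := by
  cases t with
  | zero => exact measurable_const
  | succ n =>
    exact ((π.next n).measurable_coe (measurableSet_singleton a)).comp
      (Preorder.measurable_frestrictLe n)

lemma armProb_congr {t : ℕ} {ω ω' : ℕ → Fin K × ℝ} (h : ∀ s < t, ω s = ω' s) (a : Fin K) :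
    π.armProb t ω a = π.armProb t ω' a := by
  cases t with
  | zero => rfl
  | succ n =>
    have : Preorder.frestrictLe (π := fun _ => Fin K × ℝ) n ω = Preorder.frestrictLe n ω' := by
      ext1 i
      exact h _ (Nat.lt_succ_of_le (Finset.mem_Iic.1 i.2))
    simp only [armProb, this]

variable (ν : Fin K → Measure ℝ) [∀ a, IsProbabilityMeasure (ν a)]

instance : IsProbabilityMeasure (π.law ν) := by
  unfold law; infer_instance

lemma map_law_zero : (π.law ν).map (fun ω => ω 0) = π.first ⊗ₘ armKernel ν := by
  have h : (fun ω : ℕ → Fin K × ℝ => ω 0) =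
      (MeasurableEquiv.piUnique (fun _ : Finset.Iic 0 => Fin K × ℝ)) ∘
        (Preorder.frestrictLe (π := fun _ => Fin K × ℝ) 0) := by
    ext1 ω; rfl
  rw [h, ← Measure.map_map (by fun_prop) (by fun_prop), law, Kernel.trajMeasure,
    Measure.map_comp _ _ (by fun_prop), Kernel.traj_map_frestrictLe, Kernel.partialTraj_self,
    Measure.id_comp, Measure.map_map (by fun_prop) (by fun_prop)]
  convert! Measure.map_id

/-- Disintegration of the law of the trajectory at round `t + 1`. -/
lemma lintegral_law_step {t : ℕ} {G : (ℕ → Fin K × ℝ) → ℝ≥0∞} (hG : Measurable G)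
    (hdep : DependsOn G (Iic t)) :
    ∫⁻ ω, G ω ∂(π.law ν) = ∫⁻ ω, ∑ a, π.armProb t ω a *
      ∫⁻ x, G (Function.update ω t (a, x)) ∂(ν a) ∂(π.law ν) := by
  cases t with
  | zero =>
    have h0 : ∀ y : Fin K × ℝ, ∀ ω, G (Function.update ω 0 y) = G (fun _ => y) := by
      intro y ω
      apply hdep
      intro i hi
      obtain rfl : i = 0 := by simpa using hi
      simp
    have h1 : ∀ ω, G ω = G (fun _ => ω 0) := by
      intro ω
      apply hdep
      intro i hi
      obtain rfl : i = 0 := by simpa using hi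
      rfl
    have hm : Measurable fun y : Fin K × ℝ => G (fun _ => y) :=
      hG.comp (measurable_pi_lambda _ fun _ => measurable_id)
    simp only [h0, armProb, lintegral_const, measure_univ, mul_one]
    conv_lhs => enter [2, ω]; rw [h1 ω]
    rw [← lintegral_map (f := fun y => G (fun _ => y)) hm (measurable_pi_apply 0), map_law_zero,
      Measure.lintegral_compProd hm, lintegral_fintype]
    refine Finset.sum_congr rfl fun a _ => ?_
    rw [mul_comm]
    rfl
  | succ n =>
    obtain ⟨a₀⟩ : Nonempty (Fin K) := by
      by_contra h
      rw [not_nonempty_iff] at h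
      have := measure_univ (μ := π.first)
      rw [Set.univ_eq_empty_iff.2 h, measure_empty] at this
      exact zero_ne_one this
    -- Completes a history and one more round to a full trajectory. The padding after round `n + 1`
    -- is irrelevant because `G` depends only on coordinates up to `n + 1`.
    let e : ((i : Finset.Iic n) → Fin K × ℝ) × (Fin K × ℝ) → (ℕ → Fin K × ℝ) :=
      fun p i => if hi : i ∈ Finset.Iic n then p.1 ⟨i, hi⟩ else if i = n + 1 then p.2 else (a₀, 0)
    have he : Measurable e := by
      refine measurable_pi_lambda _ fun i => ?_
      by_cases hi : i ∈ Finset.Iic n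
      · simp only [e, hi, dite_true]; fun_prop
      · by_cases h2 : i = n + 1
        · simp only [e, hi, dite_false, if_pos h2]; fun_prop
        · simp only [e, hi, dite_false, if_neg h2]; fun_prop
    have hGe : Measurable fun p => G (e p) := hG.comp he
    have h1 : ∀ ω y, G (Function.update ω (n + 1) y) =
        G (e (Preorder.frestrictLe (π := fun _ => Fin K × ℝ) n ω, y)) := by
      intro ω y
      apply hdep
      intro i hi
      by_cases h2 : i = n + 1
      · subst h2; simp [e]
      · have : i ≤ n := by simp only [Set.mem_Iic] at hi; omega
        simp [e, this, h2, Function.update_of_ne]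
    have h2 : ∀ ω, G ω = G (e (Preorder.frestrictLe (π := fun _ => Fin K × ℝ) n ω, ω (n + 1))) := by
      intro ω; rw [← h1, Function.update_eq_self]
    have h3 := Kernel.map_frestrictLe_trajMeasure_compProd_eq_map_trajMeasure
      (X := fun _ => Fin K × ℝ) (μ₀ := π.first ⊗ₘ armKernel ν)
      (κ := fun n => π.next n ⊗ₖ Kernel.prodMkLeft _ (armKernel ν)) (a := n)
    change (π.law ν).map (Preorder.frestrictLe (π := fun _ => Fin K × ℝ) n) ⊗ₘ _ =
      (π.law ν).map _ at h3
    have h4 : ∫⁻ ω, G ω ∂(π.law ν) = ∫⁻ p, G (e p) ∂((π.law ν).map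
        fun ω => (Preorder.frestrictLe (π := fun _ => Fin K × ℝ) n ω, ω (n + 1))) := by
      rw [lintegral_map hGe (by fun_prop)]
      exact lintegral_congr h2
    rw [h4, ← h3, Measure.lintegral_compProd hGe, lintegral_map (Measurable.lintegral_kernel_prod_right' hGe)
      (by fun_prop)]
    refine lintegral_congr fun ω => ?_
    rw [Kernel.lintegral_compProd _ _ _
      (f := fun b => G (e (Preorder.frestrictLe (π := fun _ => Fin K × ℝ) n ω, b)))
      (hGe.comp (by fun_prop)), lintegral_fintype]
    refine Finset.sum_congr rfl fun a _ => ?_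
    rw [mul_comm]
    simp only [h1]
    rfl

lemma measurable_lintegral_update {G : (ℕ → Fin K × ℝ) → ℝ≥0∞} (hG : Measurable G) (t : ℕ)
    (a : Fin K) (η : Measure ℝ) [SFinite η] :
    Measurable fun ω => ∫⁻ x, G (Function.update ω t (a, x)) ∂η := by
  refine Measurable.lintegral_prod_right'
    (f := fun p : (ℕ → Fin K × ℝ) × ℝ => G (Function.update p.1 t (a, p.2))) (hG.comp ?_)
  refine measurable_pi_lambda _ fun i => ?_
  by_cases h : i = t
  · subst h; simp only [Function.update_self]; fun_prop
  · simp only [Function.update_of_ne h]; fun_prop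

/-- Change of measure: the law under `ν'` has density `∏ p` with respect to the law under `ν` on
events that depend on the first `t` rounds. -/
lemma lintegral_law_mul_prod_density (ν' : Fin K → Measure ℝ) [∀ a, IsProbabilityMeasure (ν' a)]
    {p : Fin K → ℝ → ℝ≥0∞} (hp : ∀ a, Measurable (p a))
    (hν : ∀ a, ν' a = (ν a).withDensity (p a)) (t : ℕ) :
    ∀ {G : (ℕ → Fin K × ℝ) → ℝ≥0∞}, Measurable G → DependsOn G (Iio t) →
      ∫⁻ ω, G ω * ∏ s ∈ Finset.range t, p (ω s).1 (ω s).2 ∂(π.law ν) =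
        ∫⁻ ω, G ω ∂(π.law ν') := by
  have hp' : Measurable fun y : Fin K × ℝ => p y.1 y.2 :=
    measurable_from_prod_countable_right hp
  have hprod : ∀ t, Measurable fun ω : ℕ → Fin K × ℝ =>
      ∏ s ∈ Finset.range t, p (ω s).1 (ω s).2 := fun t =>
    Finset.measurable_prod _ fun s _ => hp'.comp (measurable_pi_apply s)
  induction t with
  | zero =>
    intro G hG hdep
    obtain ⟨ω₀⟩ : Nonempty (ℕ → Fin K × ℝ) := nonempty_of_isProbabilityMeasure (π.law ν)
    have : ∀ ω, G ω = G ω₀ := fun ω => hdep (by simp)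
    simp [this]
  | succ t ih =>
    intro G hG hdep
    have hd : DependsOn G (Iic t) := hdep.mono fun i hi => Nat.lt_succ_iff.1 hi
    rw [lintegral_law_step π ν (t := t)
      (G := fun ω => G ω * ∏ s ∈ Finset.range (t + 1), p (ω s).1 (ω s).2) (hG.mul (hprod _)),
      lintegral_law_step π ν' hG hd]
    -- The arm probabilities are common to both models, so integrating out round `t` leaves on both
    -- sides the same function of the first `t` rounds, up to the earlier densities; the induction
    -- hypothesis removes these.
    · rw [← ih]
      · refine lintegral_congr fun ω => ?_
        rw [Finset.sum_mul]
        refine Finset.sum_congr rfl fun a _ => ?_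
        rw [mul_assoc]
        congr 1
        have hGu : Measurable fun x => G (Function.update ω t (a, x)) := by
          refine hG.comp (measurable_pi_lambda _ fun i => ?_)
          by_cases h : i = t
          · subst h; simp only [Function.update_self]; fun_prop
          · simp only [Function.update_of_ne h]; fun_prop
        rw [hν a, lintegral_withDensity_eq_lintegral_mul _ (hp a) hGu,
          ← lintegral_mul_const _ ((hp a).mul hGu)]
        refine lintegral_congr fun x => ?_
        rw [Finset.prod_range_succ]
        have : ∏ s ∈ Finset.range t, p (Function.update ω t (a, x) s).1
            (Function.update ω t (a, x) s).2 = ∏ s ∈ Finset.range t, p (ω s).1 (ω s).2 := by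
          refine Finset.prod_congr rfl fun s hs => ?_
          rw [Function.update_of_ne (Finset.mem_range.1 hs).ne]
        rw [this]
        simp only [Function.update_self, Pi.mul_apply]
        ring
      · exact Finset.measurable_sum _ fun a _ =>
          (π.measurable_armProb t a).mul (measurable_lintegral_update hG t a _)
      · intro ω ω' h
        refine Finset.sum_congr rfl fun a _ => ?_
        rw [π.armProb_congr h]
        congr 1
        refine lintegral_congr fun x => hd fun i hi => ?_
        by_cases h2 : i = t
        · subst h2; simp
        · rw [Function.update_of_ne h2, Function.update_of_ne h2]
          exact h i (lt_of_le_of_ne hi h2)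
    · intro ω ω' h
      change G ω * _ = G ω' * _
      rw [hd h]
      congr 1
      refine Finset.prod_congr rfl fun s hs => ?_
      rw [h s (Nat.lt_succ_iff.1 (Finset.mem_range.1 hs))]

/-- On a past event, the observation of the next round is distributed according to the law of the
selected arm. -/
lemma map_restrict_law {t : ℕ} {B : Set (ℕ → Fin K × ℝ)} (hB : MeasurableSet B)
    (hdep : DependsOn (fun ω => ω ∈ B) (Iio t)) (a : Fin K) :
    ((π.law ν).restrict (B ∩ {ω | (ω t).1 = a})).map (fun ω => (ω t).2) =
      π.law ν (B ∩ {ω | (ω t).1 = a}) • ν a := by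
  -- The factor besides `ν a C` does not involve `C`; the case `C = univ` identifies it with the
  -- mass of the conditioning event.
  have key : ∀ C : Set ℝ, MeasurableSet C →
      π.law ν (B ∩ {ω | (ω t).1 = a} ∩ {ω | (ω t).2 ∈ C}) =
        ν a C * ∫⁻ ω in B, π.armProb t ω a ∂(π.law ν) := by
    intro C hC
    have hS : MeasurableSet (B ∩ {ω : ℕ → Fin K × ℝ | (ω t).1 = a} ∩ {ω | (ω t).2 ∈ C}) := by
      refine (hB.inter ?_).inter ?_
      · exact (measurable_fst.comp (measurable_pi_apply t)) (measurableSet_singleton a)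
      · exact (measurable_snd.comp (measurable_pi_apply t)) hC
    rw [← lintegral_indicator_one hS, lintegral_law_step π ν (t := t)
      (measurable_one.indicator hS), ← lintegral_indicator hB, ← lintegral_const_mul _
      ((π.measurable_armProb t a).indicator hB)]
    · refine lintegral_congr fun ω => ?_
      have hu : ∀ y, (Function.update ω t y ∈ B) = (ω ∈ B) := fun y =>
        hdep fun i hi => Function.update_of_ne (ne_of_lt hi) _ _
      rw [Finset.sum_eq_single a]
      · by_cases hω : ω ∈ B
        · rw [indicator_of_mem hω, mul_comm (ν a C)]
          congr 1
          rw [← lintegral_indicator_one hC]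
          refine lintegral_congr fun x => ?_
          have : Function.update ω t (a, x) ∈ B := by rwa [hu]
          have h2 : Function.update ω t (a, x) ∈
              B ∩ {ω : ℕ → Fin K × ℝ | (ω t).1 = a} ∩ {ω | (ω t).2 ∈ C} ↔ x ∈ C := by
            rw [mem_inter_iff, mem_inter_iff]
            simp [this]
          by_cases hx : x ∈ C
          · rw [indicator_of_mem (h2.2 hx), indicator_of_mem hx]; rfl
          · rw [indicator_of_notMem (mt h2.1 hx), indicator_of_notMem hx]
        · rw [indicator_of_notMem hω]
          simp [indicator, hu, hω]
      · intro a' _ ha'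
        simp [indicator, ha']
      · simp
    · intro ω ω' h
      have h1 : (ω ∈ B) = (ω' ∈ B) := hdep fun i hi => h i (mem_Iic.2 (mem_Iio.1 hi).le)
      have h2 := h t (mem_Iic.2 le_rfl)
      have h3 : ω ∈ B ∩ {ω : ℕ → Fin K × ℝ | (ω t).1 = a} ∩ {ω | (ω t).2 ∈ C} ↔
          ω' ∈ B ∩ {ω : ℕ → Fin K × ℝ | (ω t).1 = a} ∩ {ω | (ω t).2 ∈ C} := by
        rw [mem_inter_iff, mem_inter_iff, mem_inter_iff, mem_inter_iff, h1]
        simp [h2]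
      by_cases hx : ω' ∈ B ∩ {ω : ℕ → Fin K × ℝ | (ω t).1 = a} ∩ {ω | (ω t).2 ∈ C}
      · rw [indicator_of_mem (h3.2 hx), indicator_of_mem hx]; rfl
      · rw [indicator_of_notMem (mt h3.1 hx), indicator_of_notMem hx]
  have hBa := key univ MeasurableSet.univ
  simp only [mem_univ, ofPred_true, inter_univ, measure_univ, one_mul] at hBa
  ext C hC
  have hm : MeasurableSet ((fun ω : ℕ → Fin K × ℝ => (ω t).2) ⁻¹' C) :=
    (measurable_snd.comp (measurable_pi_apply t)) hC
  rw [Measure.map_apply (by fun_prop) hC, Measure.restrict_apply hm, Measure.smul_apply,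
    smul_eq_mul, hBa, mul_comm, ← key C hC, inter_comm]
  rfl

end SamplingRule

/-! ### Pull counts, rewards and empirical means -/

section Trajectory

variable {K : ℕ}

lemma pulls_zero (ω : ℕ → Fin K × ℝ) (a : Fin K) : pulls ω a 0 = 0 := by
  simp [pulls]

lemma pulls_succ (ω : ℕ → Fin K × ℝ) (a : Fin K) (t : ℕ) :
    pulls ω a (t + 1) = pulls ω a t + if (ω t).1 = a then 1 else 0 := by
  simp only [pulls, Finset.range_add_one, Finset.filter_insert]
  split_ifs <;> simp

lemma pulls_mono (ω : ℕ → Fin K × ℝ) (a : Fin K) : Monotone (pulls ω a) :=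
  monotone_nat_of_le_succ fun t => by rw [pulls_succ]; omega

lemma sum_pulls (ω : ℕ → Fin K × ℝ) (t : ℕ) : ∑ a, pulls ω a t = t := by
  induction t with
  | zero => simp [pulls_zero]
  | succ t ih => simp [pulls_succ, Finset.sum_add_distrib, ih]

lemma pulls_le (ω : ℕ → Fin K × ℝ) (a : Fin K) (t : ℕ) : pulls ω a t ≤ t := by
  conv_rhs => rw [← sum_pulls ω t]
  exact Finset.single_le_sum (f := fun a => pulls ω a t) (fun _ _ => Nat.zero_le _)
    (Finset.mem_univ a)

lemma pulls_congr {t : ℕ} {ω ω' : ℕ → Fin K × ℝ} (h : ∀ s < t, ω s = ω' s) (a : Fin K) :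
    pulls ω a t = pulls ω' a t := by
  unfold pulls
  congr 1
  refine Finset.filter_congr fun s hs => ?_
  rw [h s (Finset.mem_range.1 hs)]

/-- The sum of the observations received from the arm `a` in the first `t` rounds. -/
def reward (ω : ℕ → Fin K × ℝ) (a : Fin K) (t : ℕ) : ℝ :=
  ∑ s ∈ (Finset.range t).filter (fun s => (ω s).1 = a), (ω s).2

lemma reward_eq_empMean_mul (ω : ℕ → Fin K × ℝ) (a : Fin K) (t : ℕ) :
    reward ω a t = empMean ω t a * pulls ω a t := by
  by_cases h : pulls ω a t = 0
  · have : (Finset.range t).filter (fun s => (ω s).1 = a) = ∅ := Finset.card_eq_zero.1 h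
    simp [reward, this, h]
  · have : (pulls ω a t : ℝ) ≠ 0 := by exact_mod_cast h
    rw [empMean, div_mul_cancel₀ _ this, reward]

lemma reward_congr {t : ℕ} {ω ω' : ℕ → Fin K × ℝ} (h : ∀ s < t, ω s = ω' s) (a : Fin K) :
    reward ω a t = reward ω' a t := by
  unfold reward
  have : (Finset.range t).filter (fun s => (ω s).1 = a) =
      (Finset.range t).filter (fun s => (ω' s).1 = a) := by
    refine Finset.filter_congr fun s hs => ?_
    rw [h s (Finset.mem_range.1 hs)]
  rw [← this]
  refine Finset.sum_congr rfl fun s hs => ?_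
  rw [h s (Finset.mem_range.1 (Finset.mem_filter.1 hs).1)]

lemma empMean_congr {t : ℕ} {ω ω' : ℕ → Fin K × ℝ} (h : ∀ s < t, ω s = ω' s) :
    empMean ω t = empMean ω' t := by
  ext a
  change reward ω a t / (pulls ω a t : ℝ) = reward ω' a t / (pulls ω' a t : ℝ)
  rw [reward_congr h, pulls_congr h]

lemma measurableSet_arm_eq (t : ℕ) (a : Fin K) :
    MeasurableSet {ω : ℕ → Fin K × ℝ | (ω t).1 = a} :=
  (measurable_fst.comp (measurable_pi_apply t)) (measurableSet_singleton a)

lemma measurable_pulls (a : Fin K) (t : ℕ) :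
    Measurable fun ω : ℕ → Fin K × ℝ => pulls ω a t := by
  induction t with
  | zero => simp only [pulls_zero]; exact measurable_const
  | succ t ih =>
    simp only [pulls_succ]
    exact ih.add (Measurable.ite (measurableSet_arm_eq t a) measurable_const measurable_const)

lemma measurable_empMean (t : ℕ) : Measurable fun ω : ℕ → Fin K × ℝ => empMean ω t := by
  refine measurable_pi_lambda _ fun a => ?_
  unfold empMean
  simp only [Finset.sum_filter]
  refine Measurable.div (Finset.measurable_sum _ fun s _ => ?_)
    (measurable_from_top.comp (measurable_pulls a t))
  exact Measurable.ite (measurableSet_arm_eq s a) (by fun_prop) measurable_const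

end Trajectory

/-! ### Cells, alternatives, and measurability of the statistic and the stopping time -/

namespace IdentificationProblem

variable {F : ExpFamily} {K M : ℕ} (P : IdentificationProblem F K M)

lemma mem_interior_means {i : Fin M} {x : Fin K → ℝ} (hx : x ∈ P.cell i) (a : Fin K) :
    x a ∈ interior F.means := by
  refine mem_interior.2 ⟨Function.eval a '' P.cell i, ?_, isOpenMap_eval a _ (P.isOpen_cell i),
    mem_image_of_mem _ hx⟩
  rintro _ ⟨y, hy, rfl⟩
  exact P.cell_subset i y hy a

lemma mem_cell_iff {i j : Fin M} {x : Fin K → ℝ} (hx : x ∈ P.cell i) :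
    x ∈ P.cell j ↔ j = i := by
  constructor
  · intro h
    by_contra hne
    exact (P.disjoint_cell hne).le_bot ⟨h, hx⟩
  · rintro rfl
    exact hx

lemma mem_alt_iff {i : Fin M} {x : Fin K → ℝ} (hx : x ∈ P.cell i) {lam : Fin K → ℝ} :
    lam ∈ P.alt x ↔ ∃ j, j ≠ i ∧ lam ∈ P.cell j := by
  simp [alt, P.mem_cell_iff hx]

lemma alt_eq {i : Fin M} {x y : Fin K → ℝ} (hx : x ∈ P.cell i) (hy : y ∈ P.cell i) :
    P.alt x = P.alt y := by
  ext lam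
  rw [P.mem_alt_iff hx, P.mem_alt_iff hy]

lemma mem_means_of_mem_alt {x lam : Fin K → ℝ} (h : lam ∈ P.alt x) (a : Fin K) :
    lam a ∈ F.means := by
  simp only [alt, mem_iUnion] at h
  obtain ⟨j, -, hj⟩ := h
  exact P.cell_subset j lam hj a

lemma isOpen_domain : IsOpen P.domain := isOpen_iUnion P.isOpen_cell

section Congr

variable {t : ℕ} {ω ω' : ℕ → Fin K × ℝ}

lemma recommends_congr (h : ∀ s < t, ω s = ω' s) (i : Fin M) :
    P.Recommends ω t i ↔ P.Recommends ω' t i := by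
  simp only [Recommends, pulls_congr h, empMean_congr h]

lemma glr_congr (h : ∀ s < t, ω s = ω' s) : P.glr ω t = P.glr ω' t := by
  have hR : (∃ i, P.Recommends ω t i) ↔ ∃ i, P.Recommends ω' t i := by
    simp only [P.recommends_congr h]
  by_cases h' : ∃ i, P.Recommends ω t i
  · rw [glr, glr, if_pos h', if_pos (hR.1 h')]
    simp only [pulls_congr h, empMean_congr h]
  · rw [glr, glr, if_neg h', if_neg (mt hR.2 h')]

lemma trackingArms_congr (h : ∀ s < t, ω s = ω' s) :
    P.trackingArms ω t = P.trackingArms ω' t := by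
  have hU : underSampled ω t = underSampled ω' t := by
    simp only [underSampled, pulls_congr h]
  unfold trackingArms
  rw [hU, empMean_congr h]
  simp only [pulls_congr h]

end Congr

lemma measurableSet_recommends (t : ℕ) (i : Fin M) :
    MeasurableSet {ω | P.Recommends ω t i} := by
  have : {ω | P.Recommends ω t i} = (⋂ a, {ω | pulls ω a t = 0}ᶜ) ∩
      (fun ω => empMean ω t) ⁻¹' P.cell i := by
    ext ω; simp [Recommends]
  rw [this]
  refine (MeasurableSet.iInter fun a => ?_).inter
    (measurable_empMean t (P.isOpen_cell i).measurableSet)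
  exact (measurable_pulls a t (measurableSet_singleton 0)).compl

/-- `Alt` is constant on a cell, so the infimum is over a fixed family of functions continuous on
that cell. Such an infimum is upper semicontinuous, however large the family. -/
lemma isOpen_setOf_iInf_lt (i : Fin M) (v : Fin K → ℕ) (r : ℝ≥0∞) :
    IsOpen {x | x ∈ P.cell i ∧
      ⨅ lam ∈ P.alt x, ∑ a, (v a : ℝ≥0∞) * F.d (x a) (lam a) < r} := by
  rw [isOpen_iff_mem_nhds]
  rintro x ⟨hx, hlt⟩
  simp only [iInf_lt_iff] at hlt
  obtain ⟨lam, hlam, hlt⟩ := hlt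
  have hcell := (P.isOpen_cell i).mem_nhds hx
  have hc : ContinuousAt (fun x : Fin K → ℝ =>
      ∑ a, (v a : ℝ≥0∞) * ENNReal.ofReal (F.bregman (x a) (lam a))) x := by
    refine tendsto_finsetSum _ fun a _ => ENNReal.Tendsto.const_mul ?_ (Or.inr (by simp))
    refine ENNReal.tendsto_ofReal ?_
    have := F.continuousAt_bregman (P.mem_interior_means hx a) (lam a)
    exact this.tendsto.comp (continuous_apply a).continuousAt
  have hd : ∀ y ∈ P.cell i, ∑ a, (v a : ℝ≥0∞) * F.d (y a) (lam a) =
      ∑ a, (v a : ℝ≥0∞) * ENNReal.ofReal (F.bregman (y a) (lam a)) := fun y hy =>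
    Finset.sum_congr rfl fun a _ => by
      rw [F.d_eq (P.mem_interior_means hy a) (P.mem_means_of_mem_alt hlam a)]
  rw [hd x hx] at hlt
  filter_upwards [hcell, hc.eventually (gt_mem_nhds hlt)] with y hy hy2
  refine ⟨hy, ?_⟩
  rw [P.alt_eq hy hx]
  refine (iInf₂_le lam hlam).trans_lt ?_
  rwa [hd y hy]

/-- The infimum over `Alt` is uncountable. Splitting over the countably many cells and pull vectors
`v` reduces each sublevel set to the open sets of `isOpen_setOf_iInf_lt`. -/
lemma measurable_glr (t : ℕ) : Measurable fun ω => P.glr ω t := by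
  refine measurable_of_Iio fun r => ?_
  have : (fun ω => P.glr ω t) ⁻¹' Iio r =
      ((⋃ i, {ω | P.Recommends ω t i})ᶜ ∩ {_ω | 0 < r}) ∪
      ⋃ i, ⋃ v : Fin K → ℕ, {ω | P.Recommends ω t i} ∩ ((⋂ a, {ω | pulls ω a t = v a}) ∩
        (fun ω => empMean ω t) ⁻¹' {x | x ∈ P.cell i ∧
          ⨅ lam ∈ P.alt x, ∑ a, (v a : ℝ≥0∞) * F.d (x a) (lam a) < r}) := by
    ext ω
    by_cases h : ∃ i, P.Recommends ω t i
    · have h' : ¬ ∀ i, ¬ P.Recommends ω t i := by push Not; exact h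
      simp only [mem_preimage, mem_Iio, glr, if_pos h, mem_union, mem_inter_iff, mem_compl_iff,
        mem_iUnion, mem_ofPred_eq, not_exists, h', false_and, false_or, mem_iInter]
      constructor
      · intro hlt
        obtain ⟨i, hi⟩ := h
        exact ⟨i, fun a => pulls ω a t, hi, fun _ => rfl, hi.2, hlt⟩
      · rintro ⟨i, v, hi, hv, -, hlt⟩
        simpa only [hv] using hlt
    · have h' : ∀ i, ¬ P.Recommends ω t i := by push Not at h; exact h
      simp [glr, h']
  rw [this]
  refine (((MeasurableSet.iUnion fun i => P.measurableSet_recommends t i).compl).inter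
    (MeasurableSet.const _)).union ?_
  refine MeasurableSet.iUnion fun i => MeasurableSet.iUnion fun v =>
    (P.measurableSet_recommends t i).inter ((MeasurableSet.iInter fun a => ?_).inter ?_)
  · exact measurable_pulls a t (measurableSet_singleton (v a))
  · exact measurable_empMean t (P.isOpen_setOf_iInf_lt i v r).measurableSet

section StoppingTime

variable (c : ℕ → ℝ)

lemma stoppingTime_le {ω : ℕ → Fin K × ℝ} {t : ℕ}
    (h : ((c t : ℝ) : EReal) < ((P.glr ω t : ℝ≥0∞) : EReal)) : P.stoppingTime c ω ≤ t :=
  iInf₂_le (f := fun (t : ℕ) (_ : t ∈ {t : ℕ | ((c t : ℝ) : EReal) <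
    ((P.glr ω t : ℝ≥0∞) : EReal)}) => (t : ℕ∞)) t h

lemma lt_stoppingTime_iff {ω : ℕ → Fin K × ℝ} {s : ℕ} :
    (s : ℕ∞) < P.stoppingTime c ω ↔
      ∀ t ≤ s, ¬ ((c t : ℝ) : EReal) < ((P.glr ω t : ℝ≥0∞) : EReal) := by
  constructor
  · intro h t ht hlt
    have := h.trans_le (P.stoppingTime_le c hlt)
    exact absurd (ENat.natCast_lt_natCast.1 this) (not_lt.2 ht)
  · intro h
    have : ((s + 1 : ℕ) : ℕ∞) ≤ P.stoppingTime c ω := by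
      refine le_iInf₂ fun t ht => ?_
      by_contra hlt
      rw [not_le, ENat.natCast_lt_natCast] at hlt
      exact h t (by omega) ht
    exact (ENat.natCast_lt_natCast.2 (Nat.lt_succ_self s)).trans_le this

lemma measurableSet_lt_stoppingTime (s : ℕ) :
    MeasurableSet {ω | (s : ℕ∞) < P.stoppingTime c ω} := by
  have : {ω | (s : ℕ∞) < P.stoppingTime c ω} =
      ⋂ t ∈ Finset.range (s + 1), {ω | ((c t : ℝ) : EReal) < ((P.glr ω t : ℝ≥0∞) : EReal)}ᶜ := by
    ext ω
    simp only [mem_ofPred_eq, lt_stoppingTime_iff, mem_iInter, mem_compl_iff, Finset.mem_range,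
      Nat.lt_succ_iff]
  rw [this]
  refine Finset.measurableSet_biInter _ fun t _ => MeasurableSet.compl ?_
  exact measurableSet_lt measurable_const (P.measurable_glr t).coe_ereal_ennreal

lemma lt_stoppingTime_congr {s : ℕ} {ω ω' : ℕ → Fin K × ℝ} (h : ∀ t < s, ω t = ω' t) :
    (s : ℕ∞) < P.stoppingTime c ω ↔ (s : ℕ∞) < P.stoppingTime c ω' := by
  rw [lt_stoppingTime_iff, lt_stoppingTime_iff]
  refine forall₂_congr fun t ht => ?_
  rw [P.glr_congr fun s' hs' => h s' (by omega)]

end StoppingTime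

/-! ### Pathwise guarantees of the Tracking rule -/

section Tracking

variable {P} {ω : ℕ → Fin K × ℝ}

/-- Forced exploration: a Tracking rule samples every arm at least `√t - K - 1` times. -/
lemma sqrt_sub_le_pulls (h : ∀ t, (ω t).1 ∈ P.trackingArms ω t) (t : ℕ) (a : Fin K) :
    √(t : ℝ) - K - 1 ≤ pulls ω a t := by
  by_contra! hlt
  set n := pulls ω a t with hn
  -- From round `s₀` on, `√s - K / 2 ≥ n`. Since arm `a` has at most `n` pulls up to time `t`, it
  -- stays under-sampled, so every selected arm had at most `n` pulls.
  set s₀ := ⌈((n : ℝ) + K / 2) ^ 2⌉₊ with hs₀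
  have hstep : ∀ s < t, s₀ ≤ s → pulls ω (ω s).1 s ≤ n := by
    intro s hst hs
    have hsq : (n : ℝ) + K / 2 ≤ √(s : ℝ) :=
      Real.le_sqrt_of_sq_le ((Nat.le_ceil _).trans (by exact_mod_cast hs))
    have han : pulls ω a s ≤ n := pulls_mono ω a hst.le
    have haU : a ∈ underSampled ω s := by
      change (pulls ω a s : ℝ) ≤ max (√(s : ℝ) - K / 2) 0
      refine le_trans ?_ (le_max_left _ _)
      have : (pulls ω a s : ℝ) ≤ n := by exact_mod_cast han
      linarith
    have := h s
    rw [trackingArms, if_pos ⟨a, haU⟩] at this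
    exact (this.2 a haU).trans han
  -- The potential `∑ b, min (N_b) (n + 1)` gains at least one per round after `s₀`, and it never
  -- exceeds `K * (n + 1)`. This bounds `t` by `s₀ + K * (n + 1)`, which is less than `(n + K + 1) ^
  -- 2`.
  have hΦ : ∀ j, s₀ + j ≤ t → j ≤ ∑ b, min (pulls ω b (s₀ + j)) (n + 1) := by
    intro j
    induction j with
    | zero => intro _; exact Nat.zero_le _
    | succ j ih =>
      intro hj
      have h1 := hstep (s₀ + j) (by omega) (by omega)
      have h2 := ih (by omega)
      have h3 : ∑ b, min (pulls ω b (s₀ + j)) (n + 1) <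
          ∑ b, min (pulls ω b (s₀ + (j + 1))) (n + 1) := by
        refine Finset.sum_lt_sum (fun b _ => ?_) ⟨(ω (s₀ + j)).1, Finset.mem_univ _, ?_⟩
        · exact min_le_min_right _ (pulls_mono ω b (Nat.le_succ (s₀ + j)))
        · rw [← add_assoc, pulls_succ, if_pos rfl]
          omega
      omega
  have hcard : ∑ b, min (pulls ω b t) (n + 1) ≤ K * (n + 1) := by
    calc ∑ b, min (pulls ω b t) (n + 1) ≤ ∑ _b : Fin K, (n + 1) :=
          Finset.sum_le_sum fun b _ => min_le_right _ _
      _ = K * (n + 1) := by simp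
  have ht : t ≤ s₀ + K * (n + 1) := by
    by_cases hts : s₀ ≤ t
    · have := hΦ (t - s₀) (by omega)
      rw [Nat.add_sub_cancel' hts] at this
      omega
    · omega
  have h1 : (t : ℝ) ≤ s₀ + K * (n + 1) := by exact_mod_cast ht
  have h2 : (s₀ : ℝ) < ((n : ℝ) + K / 2) ^ 2 + 1 := Nat.ceil_lt_add_one (by positivity)
  have h3 : ((n : ℝ) + K + 1) < √(t : ℝ) := by linarith
  have h4 : ((n : ℝ) + K + 1) ^ 2 < t := (Real.lt_sqrt (by positivity)).1 h3
  have hn0 : (0 : ℝ) ≤ n := n.cast_nonneg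
  have hK0 : (0 : ℝ) ≤ K := K.cast_nonneg
  nlinarith

/-- If the target weights stay `ε`-close to `w` from round `t₀` on, then the sampling proportions
are close to `w`. -/
lemma mul_sub_le_pulls (h : ∀ t, (ω t).1 ∈ P.trackingArms ω t) {w : Fin K → ℝ}
    (hw : w ∈ stdSimplex ℝ (Fin K)) {ε : ℝ} (hε : 0 < ε) {t₀ : ℕ} (ht₀ : 1 / ε ^ 2 ≤ t₀)
    (hclose : ∀ t ≥ t₀, empMean ω t ∈ P.domain ∧
      P.optWeights (empMean ω t) ∈ stdSimplex ℝ (Fin K) ∧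
      ∀ a, P.optWeights (empMean ω t) a ≤ w a + ε) {t : ℕ} (ht : t₀ ≤ t) (a : Fin K) :
    t * w a - K * (t₀ + t * ε + 1) ≤ pulls ω a t := by
  -- An arm can be selected only if it is not over-sampled. In a forced round its count is at most
  -- `√t`, which is at most `t * ε` because `t ≥ 1 / ε ^ 2`.
  have hsel : ∀ t ≥ t₀, (pulls ω (ω t).1 t : ℝ) ≤ t * w (ω t).1 + t * ε := by
    intro t ht
    have htr : (t₀ : ℝ) ≤ t := by exact_mod_cast ht
    have hsel := h t
    by_cases hU : (underSampled ω t).Nonempty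
    · rw [trackingArms, if_pos hU] at hsel
      have h1 : (pulls ω (ω t).1 t : ℝ) ≤ max (√(t : ℝ) - K / 2) 0 := hsel.1
      have h2 : max (√(t : ℝ) - K / 2) 0 ≤ √(t : ℝ) := by
        refine max_le ?_ (Real.sqrt_nonneg _)
        have : (0 : ℝ) ≤ K / 2 := by positivity
        linarith
      have h3 : 1 / ε ≤ √(t : ℝ) := by
        refine Real.le_sqrt_of_sq_le ?_
        rw [div_pow, one_pow]
        linarith
      have h4 : √(t : ℝ) ≤ t * ε := by
        rw [div_le_iff₀ hε] at h3
        calc √(t : ℝ) = √(t : ℝ) * 1 := (mul_one _).symm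
          _ ≤ √(t : ℝ) * (√(t : ℝ) * ε) := by gcongr
          _ = t * ε := by rw [← mul_assoc, Real.mul_self_sqrt t.cast_nonneg]
      have h5 : 0 ≤ t * w (ω t).1 := mul_nonneg t.cast_nonneg (hw.1 _)
      linarith
    · obtain ⟨hdom, hsimp, hle⟩ := hclose t ht
      rw [trackingArms, if_neg hU, if_pos hdom] at hsel
      set v := P.optWeights (empMean ω t)
      -- The deficits `t * v b - N_b` sum to zero over the arms, so the largest one is nonnegative.
      have h1 : 0 ≤ t * v (ω t).1 - pulls ω (ω t).1 t := by
        by_contra! hneg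
        have h2 : ∑ a, (t * v a - (pulls ω a t : ℝ)) < 0 :=
          Finset.sum_neg (fun a _ => (hsel a).trans_lt hneg) ⟨(ω t).1, Finset.mem_univ _⟩
        rw [Finset.sum_sub_distrib, ← Finset.mul_sum, hsimp.2, ← Nat.cast_sum, sum_pulls] at h2
        simp at h2
      have h3 : t * v (ω t).1 ≤ t * (w (ω t).1 + ε) :=
        mul_le_mul_of_nonneg_left (hle _) t.cast_nonneg
      linarith
  have hup : ∀ t ≥ t₀, ∀ a, (pulls ω a t : ℝ) ≤ t * w a + (t₀ + t * ε + 1) := by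
    intro t ht
    induction t, ht using Nat.le_induction with
    | base =>
      intro a
      have h1 : (pulls ω a t₀ : ℝ) ≤ t₀ := by exact_mod_cast pulls_le ω a t₀
      have h2 : 0 ≤ t₀ * w a := mul_nonneg t₀.cast_nonneg (hw.1 _)
      have h3 : 0 ≤ t₀ * ε := by positivity
      linarith
    | succ t ht ih =>
      intro a
      have h2 := hw.1 a
      rw [pulls_succ]
      push_cast
      by_cases ha : (ω t).1 = a
      · have h1 := hsel t ht
        rw [ha] at h1
        rw [if_pos ha]
        have : (0 : ℝ) ≤ t₀ := t₀.cast_nonneg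
        linarith
      · rw [if_neg ha]
        have := ih a
        linarith
  -- The counts sum to `t` and the weights to `1`, so upper bounds on the other arms yield the lower
  -- bound on arm `a`; this costs the factor `K`.
  have hsum : (pulls ω a t : ℝ) = t - ∑ b ∈ Finset.univ.erase a, (pulls ω b t : ℝ) := by
    rw [eq_sub_iff_add_eq, Finset.add_sum_erase _ (fun b => (pulls ω b t : ℝ)) (Finset.mem_univ a),
      ← Nat.cast_sum,
      sum_pulls]
  have hwsum : w a = 1 - ∑ b ∈ Finset.univ.erase a, w b := by
    rw [eq_sub_iff_add_eq, Finset.add_sum_erase _ w (Finset.mem_univ a), hw.2]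
  have hB : 0 ≤ (t₀ : ℝ) + t * ε + 1 := by positivity
  have h5 : ∑ b ∈ Finset.univ.erase a, (pulls ω b t : ℝ) ≤
      t * ∑ b ∈ Finset.univ.erase a, w b + K * (t₀ + t * ε + 1) := by
    calc ∑ b ∈ Finset.univ.erase a, (pulls ω b t : ℝ) ≤
        ∑ b ∈ Finset.univ.erase a, (t * w b + (t₀ + t * ε + 1)) :=
          Finset.sum_le_sum fun b _ => hup t ht b
      _ = t * ∑ b ∈ Finset.univ.erase a, w b +
          (Finset.univ.erase a).card * ((t₀ : ℝ) + t * ε + 1) := by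
        rw [Finset.sum_add_distrib, Finset.mul_sum, Finset.sum_const, nsmul_eq_mul]
      _ ≤ _ := by
        gcongr
        refine (Finset.card_le_univ _).trans ?_
        simp
  rw [hsum, hwsum]
  linarith

end Tracking

/-! ### Almost every trajectory obeys the Tracking rule -/

section AlmostSure

variable {P}

/-- Outside the domain `optWeights` is an arbitrary choice with no regularity; the indicator
discards those values, which the Tracking rule never consults. -/
lemma measurable_indicator_optWeights (hcont : ∀ i, ContinuousOn P.optWeights (P.cell i)) :
    Measurable (P.domain.indicator P.optWeights) := by
  have h : ContinuousOn P.optWeights P.domain := by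
    refine continuousOn_of_forall_continuousAt fun x hx => ?_
    obtain ⟨i, hi⟩ := mem_iUnion.1 hx
    exact (hcont i).continuousAt ((P.isOpen_cell i).mem_nhds hi)
  classical
  rw [← piecewise_eq_indicator]
  exact h.measurable_piecewise continuousOn_const P.isOpen_domain.measurableSet

lemma measurableSet_mem_trackingArms (hcont : ∀ i, ContinuousOn P.optWeights (P.cell i)) (t : ℕ)
    (a : Fin K) : MeasurableSet {ω | a ∈ P.trackingArms ω t} := by
  have hN : ∀ a, Measurable fun ω : ℕ → Fin K × ℝ => (pulls ω a t : ℝ) := fun a =>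
    measurable_from_top.comp (measurable_pulls a t)
  have hU : ∀ a, MeasurableSet {ω : ℕ → Fin K × ℝ | a ∈ underSampled ω t} := fun a =>
    measurableSet_le (hN a) measurable_const
  have hD : MeasurableSet {ω : ℕ → Fin K × ℝ | empMean ω t ∈ P.domain} :=
    measurable_empMean t P.isOpen_domain.measurableSet
  have hW : ∀ a, Measurable fun ω : ℕ → Fin K × ℝ =>
      (t : ℝ) * P.domain.indicator P.optWeights (empMean ω t) a - pulls ω a t := fun a =>
    (measurable_const.mul ((measurable_pi_apply a).comp
      ((measurable_indicator_optWeights hcont).comp (measurable_empMean t)))).sub (hN a)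
  have : {ω | a ∈ P.trackingArms ω t} =
      ((⋃ b, {ω | b ∈ underSampled ω t}) ∩ ({ω | a ∈ underSampled ω t} ∩
        ⋂ b, ({ω | b ∈ underSampled ω t}ᶜ ∪ {ω | pulls ω a t ≤ pulls ω b t}))) ∪
      ((⋃ b, {ω | b ∈ underSampled ω t})ᶜ ∩ ({ω | empMean ω t ∈ P.domain}ᶜ ∪
        ⋂ b, {ω | (t : ℝ) * P.domain.indicator P.optWeights (empMean ω t) b - pulls ω b t ≤
          (t : ℝ) * P.domain.indicator P.optWeights (empMean ω t) a - pulls ω a t})) := by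
    ext ω
    by_cases h : (underSampled ω t).Nonempty
    · have h' : ∃ b, b ∈ underSampled ω t := h
      simp only [trackingArms, if_pos h, mem_ofPred_eq, mem_union, mem_inter_iff, mem_iUnion,
        mem_compl_iff, mem_iInter, h', not_true, false_and, or_false, true_and, imp_iff_not_or]
    · have h' : ¬ ∃ b, b ∈ underSampled ω t := h
      simp only [trackingArms, if_neg h, mem_ofPred_eq, mem_union, mem_inter_iff, mem_iUnion,
        mem_compl_iff, mem_iInter, h', not_false_iff, false_and, false_or, true_and]
      by_cases hd : empMean ω t ∈ P.domain
      · simp [hd]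
      · simp [hd]
  rw [this]
  refine (MeasurableSet.inter (.iUnion hU) ((hU a).inter (.iInter fun b => (hU b).compl.union ?_))).union
    ((MeasurableSet.iUnion hU).compl.inter (hD.compl.union (.iInter fun b => ?_)))
  · exact measurableSet_le (measurable_pulls a t) (measurable_pulls b t)
  · exact measurableSet_le (hW b) (hW a)

lemma IsTracking.armProb_eq_zero {π : SamplingRule K} (hπ : P.IsTracking π) {t : ℕ}
    {ω : ℕ → Fin K × ℝ} {a : Fin K} (ha : a ∉ P.trackingArms ω t) : π.armProb t ω a = 0 := by
  cases t with
  | zero => exact measure_mono_null (singleton_subset_iff.2 ha) (hπ.1 ω)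
  | succ n => exact measure_mono_null (singleton_subset_iff.2 ha) (hπ.2 n ω)

lemma IsTracking.ae_mem_trackingArms {π : SamplingRule K} (hπ : P.IsTracking π)
    (hcont : ∀ i, ContinuousOn P.optWeights (P.cell i)) (ν : Fin K → Measure ℝ)
    [∀ a, IsProbabilityMeasure (ν a)] :
    ∀ᵐ ω ∂(π.law ν), ∀ t, (ω t).1 ∈ P.trackingArms ω t := by
  rw [ae_all_iff]
  intro t
  have hS : MeasurableSet {ω | (ω t).1 ∉ P.trackingArms ω t} := by
    have : {ω | (ω t).1 ∉ P.trackingArms ω t} =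
        ⋃ a, ({ω | (ω t).1 = a} ∩ {ω | a ∈ P.trackingArms ω t}ᶜ) := by
      ext ω; simp
    rw [this]
    exact .iUnion fun a => (measurableSet_arm_eq t a).inter
      (measurableSet_mem_trackingArms hcont t a).compl
  rw [ae_iff, ← lintegral_indicator_one hS, π.lintegral_law_step ν (t := t)
    (measurable_one.indicator hS)]
  · refine (lintegral_congr fun ω => ?_).trans lintegral_zero
    refine Finset.sum_eq_zero fun a _ => ?_
    by_cases ha : a ∈ P.trackingArms ω t
    · have : ∀ x, Function.update ω t (a, x) ∉ {ω | (ω t).1 ∉ P.trackingArms ω t} := by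
        intro x
        have h2 : P.trackingArms (Function.update ω t (a, x)) t = P.trackingArms ω t :=
          P.trackingArms_congr fun s hs => Function.update_of_ne hs.ne _ _
        simpa [h2] using ha
      simp only [indicator_of_notMem (this _), lintegral_zero, mul_zero]
    · rw [hπ.armProb_eq_zero ha, zero_mul]
  · intro ω ω' h
    have h1 := P.trackingArms_congr fun s hs => h s (mem_Iic.2 (le_of_lt hs))
    have h2 := h t (mem_Iic.2 le_rfl)
    have h3 : ω ∈ {ω | (ω t).1 ∉ P.trackingArms ω t} ↔
        ω' ∈ {ω | (ω t).1 ∉ P.trackingArms ω t} := by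
      simp only [mem_ofPred_eq, h1, h2]
    by_cases hx : ω' ∈ {ω | (ω t).1 ∉ P.trackingArms ω t}
    · rw [indicator_of_mem (h3.2 hx), indicator_of_mem hx]; rfl
    · rw [indicator_of_notMem (mt h3.1 hx), indicator_of_notMem hx]

end AlmostSure

end IdentificationProblem

/-! ### Log-likelihood ratios between bandit models -/

namespace ExpFamily

variable (F : ExpFamily)

/-- The log-likelihood ratio of the bandit models `μ` and `μ'` after `t` rounds. -/
def logLik {K : ℕ} (μ μ' : Fin K → ℝ) (ω : ℕ → Fin K × ℝ) (t : ℕ) : ℝ :=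
  ∑ s ∈ Finset.range t, F.logRatio (μ (ω s).1) (μ' (ω s).1) (ω s).2

lemma measurable_logRatio_arm {K : ℕ} (μ μ' : Fin K → ℝ) :
    Measurable fun y : Fin K × ℝ => F.logRatio (μ y.1) (μ' y.1) y.2 :=
  measurable_from_prod_countable_right fun a => F.measurable_logRatio (μ a) (μ' a)

lemma measurable_logLik {K : ℕ} (μ μ' : Fin K → ℝ) (t : ℕ) :
    Measurable fun ω => F.logLik μ μ' ω t :=
  Finset.measurable_sum _ fun s _ =>
    (F.measurable_logRatio_arm μ μ').comp (measurable_pi_apply s)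

lemma lintegral_law_mul_exp_logLik {K : ℕ} (π : SamplingRule K) {μ μ' : Fin K → ℝ}
    (hμ : ∀ a, μ a ∈ F.means) (hμ' : ∀ a, μ' a ∈ F.means) {t : ℕ}
    {G : (ℕ → Fin K × ℝ) → ℝ≥0∞} (hG : Measurable G) (hdep : DependsOn G (Iio t)) :
    ∫⁻ ω, G ω * ENNReal.ofReal (Real.exp (F.logLik μ' μ ω t)) ∂(π.law fun a => F.dist (μ a)) =
      ∫⁻ ω, G ω ∂(π.law fun a => F.dist (μ' a)) := by
  rw [← π.lintegral_law_mul_prod_density (fun a => F.dist (μ a)) (fun a => F.dist (μ' a))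
    (p := fun a z => ENNReal.ofReal (Real.exp (F.logRatio (μ' a) (μ a) z)))
    (fun a => by have := F.measurable_logRatio (μ' a) (μ a); fun_prop)
    (fun a => F.dist_eq_withDensity (hμ a) (hμ' a)) t hG hdep]
  refine lintegral_congr fun ω => ?_
  rw [logLik, Real.exp_sum, ENNReal.ofReal_prod_of_nonneg fun _ _ => (Real.exp_pos _).le]

/-- Only the rounds of arm `a` contribute, and the ratio is affine in the observation, so these
rounds enter only through their number and their mean. -/
lemma logLik_update {K : ℕ} (μ : Fin K → ℝ) (a : Fin K) (y : ℝ) (ω : ℕ → Fin K × ℝ) (t : ℕ) :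
    F.logLik (Function.update μ a y) μ ω t =
      pulls ω a t * F.logRatio y (μ a) (empMean ω t a) := by
  have h1 : F.logLik (Function.update μ a y) μ ω t =
      ∑ s ∈ (Finset.range t).filter (fun s => (ω s).1 = a), F.logRatio y (μ a) (ω s).2 := by
    rw [logLik, Finset.sum_filter]
    refine Finset.sum_congr rfl fun s _ => ?_
    split_ifs with h
    · rw [h, Function.update_self]
    · rw [Function.update_of_ne h]; simp [logRatio]
  rw [h1]
  simp only [logRatio]
  rw [Finset.sum_sub_distrib, ← Finset.mul_sum, Finset.sum_const, nsmul_eq_mul]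
  change _ * reward ω a t - (pulls ω a t : ℝ) * _ = _
  rw [reward_eq_empMean_mul]
  ring

end ExpFamily

/-- The sixth term of the exponential series gives `exp (-κ √t) ≤ 720 / (κ ^ 6 * t ^ 3)`, and `t + 1
≤ 2 * t` for `t ≥ 1`; hence the constant `1440` and a summable `1 / t ^ 2`. -/
lemma tsum_mul_exp_sqrt_ne_top {κ : ℝ} (hκ : 0 < κ) (b : ℝ) :
    ∑' t : ℕ, ((t : ℝ≥0∞) + 1) * ENNReal.ofReal (Real.exp (-(κ * (√(t : ℝ) - b)))) ≠ ∞ := by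
  have hs : Summable fun t : ℕ => ((t : ℝ) + 1) * Real.exp (-(κ * (√(t : ℝ) - b))) := by
    have hp : Summable fun t : ℕ => (Real.exp (κ * b) * (1440 / κ ^ 6)) * (1 / (t : ℝ) ^ 2) :=
      (Real.summable_one_div_nat_pow.2 one_lt_two).mul_left _
    refine hp.of_norm_bounded_eventually_nat ?_
    filter_upwards [eventually_ge_atTop 1] with t ht
    have ht' : (1 : ℝ) ≤ t := by exact_mod_cast ht
    have h1 := Real.pow_div_factorial_le_exp (x := κ * √(t : ℝ)) (by positivity) 6
    have h2 : (κ * √(t : ℝ)) ^ 6 = κ ^ 6 * (t : ℝ) ^ 3 := by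
      rw [mul_pow, show (√(t : ℝ)) ^ 6 = ((√(t : ℝ)) ^ 2) ^ 3 by ring, Real.sq_sqrt t.cast_nonneg]
    have h3 : ((6).factorial : ℝ) = 720 := by norm_num [Nat.factorial]
    rw [h2, h3] at h1
    have h4 : Real.exp (-(κ * √(t : ℝ))) ≤ 720 / (κ ^ 6 * (t : ℝ) ^ 3) := by
      rw [Real.exp_neg, ← inv_div]
      exact inv_anti₀ (by positivity) h1
    rw [Real.norm_of_nonneg (by positivity)]
    calc ((t : ℝ) + 1) * Real.exp (-(κ * (√(t : ℝ) - b)))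
        = ((t : ℝ) + 1) * (Real.exp (κ * b) * Real.exp (-(κ * √(t : ℝ)))) := by
          rw [← Real.exp_add]; ring_nf
      _ ≤ (2 * (t : ℝ)) * (Real.exp (κ * b) * (720 / (κ ^ 6 * (t : ℝ) ^ 3))) := by
          gcongr; linarith
      _ = _ := by field_simp; ring
  have := hs.tsum_ofReal_ne_top
  convert! this using 3 with t
  rw [ENNReal.ofReal_mul (by positivity), ENNReal.ofReal_add t.cast_nonneg zero_le_one]
  simp

namespace IdentificationProblem

variable {F : ExpFamily} {K M : ℕ} {P : IdentificationProblem F K M}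

instance (π : SamplingRule K) (μ : Fin K → ℝ) : IsProbabilityMeasure (P.law π μ) := by
  unfold law; infer_instance

/-! ### Concentration of the empirical means -/

section Concentration

/-- The event says that the empirical mean of arm `a` lies at or beyond `y`, seen from `μ a`. There
the likelihood ratio of the model with `μ a` replaced by `y` is at least `exp (N_a * d(y, μ a))`,
with `N_a ≥ √t - K - 1`. That ratio has mean one, so Markov's inequality concludes with no union
bound over the random number of pulls. -/
lemma law_deviation_le {π : SamplingRule K} (hπ : P.IsTracking π)
    (hcont : ∀ i, ContinuousOn P.optWeights (P.cell i)) {μ : Fin K → ℝ} (hμ : ∀ a, μ a ∈ F.means) {y : ℝ} (hy : y ∈ F.means)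
    (a : Fin K) (t : ℕ) :
    P.law π μ {ω | 0 ≤ (F.natParam y - F.natParam (μ a)) * (empMean ω t a - y)} ≤
      ENNReal.ofReal (Real.exp (-(F.bregman y (μ a) * (√(t : ℝ) - (K + 1))))) := by
  set κ := F.bregman y (μ a) with hκ
  have hκ0 : 0 ≤ κ := F.bregman_nonneg hy (hμ a)
  set u := κ * (√(t : ℝ) - (K + 1)) with hu
  have hμ' : ∀ b, Function.update μ a y b ∈ F.means := by
    intro b
    by_cases h : b = a
    · subst h; simpa using hy
    · rw [Function.update_of_ne h]; exact hμ b
  have hone := F.lintegral_law_mul_exp_logLik π hμ hμ' (t := t) (G := fun _ => 1)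
    measurable_const (fun _ _ _ => rfl)
  simp only [one_mul, lintegral_const, measure_univ] at hone
  have hmarkov := mul_meas_ge_le_lintegral (μ := P.law π μ)
    (f := fun ω => ENNReal.ofReal (Real.exp (F.logLik (Function.update μ a y) μ ω t)))
    (by have := F.measurable_logLik (Function.update μ a y) μ t; fun_prop)
    (ENNReal.ofReal (Real.exp u))
  change _ ≤ ∫⁻ ω, _ ∂(π.law fun a => F.dist (μ a)) at hmarkov
  rw [hone] at hmarkov
  have hsub : P.law π μ {ω | 0 ≤ (F.natParam y - F.natParam (μ a)) * (empMean ω t a - y)} ≤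
      P.law π μ {ω | ENNReal.ofReal (Real.exp u) ≤
        ENNReal.ofReal (Real.exp (F.logLik (Function.update μ a y) μ ω t))} := by
    refine measure_mono_ae ?_
    filter_upwards [hπ.ae_mem_trackingArms hcont fun a => F.dist (μ a)] with ω hω h
    refine ENNReal.ofReal_le_ofReal (Real.exp_le_exp.2 ?_)
    have h0 : 0 ≤ (F.natParam y - F.natParam (μ a)) * (empMean ω t a - y) := h
    rw [F.logLik_update]
    have h1 : κ ≤ F.logRatio y (μ a) (empMean ω t a) := by
      have : F.logRatio y (μ a) (empMean ω t a) =
          κ + (F.natParam y - F.natParam (μ a)) * (empMean ω t a - y) := by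
        rw [hκ, ← F.logRatio_apply_mean]; unfold ExpFamily.logRatio; ring
      linarith
    have h2 := sqrt_sub_le_pulls hω t a
    calc u = κ * (√(t : ℝ) - K - 1) := by rw [hu]; ring
      _ ≤ κ * pulls ω a t := by gcongr
      _ = pulls ω a t * κ := mul_comm _ _
      _ ≤ _ := by gcongr
  refine hsub.trans ?_
  rw [Real.exp_neg, ENNReal.ofReal_inv_of_pos (Real.exp_pos _), ENNReal.le_inv_iff_mul_le,
    mul_comm]
  exact hmarkov

/-- The last exit time of the empirical means from a neighborhood of `μ` is bounded by an integrable
random variable. -/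
lemma exists_last_exit_bound {π : SamplingRule K} (hπ : P.IsTracking π)
    (hcont : ∀ i, ContinuousOn P.optWeights (P.cell i)) {i : Fin M} {μ : Fin K → ℝ} (hμ : μ ∈ P.cell i)
    {U : Set (Fin K → ℝ)} (hU : U ∈ 𝓝 μ) :
    ∃ σ : (ℕ → Fin K × ℝ) → ℝ≥0∞, ∫⁻ ω, σ ω ∂(P.law π μ) ≠ ∞ ∧ Measurable σ ∧
      ∀ ω t, empMean ω t ∉ U → (t : ℝ≥0∞) + 1 ≤ σ ω := by
  obtain ⟨r, hr, hball⟩ := Metric.mem_nhds_iff.1 (inter_mem hU ((P.isOpen_cell i).mem_nhds hμ))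
  have hμm : ∀ a, μ a ∈ F.means := P.cell_subset i μ hμ
  have hmem : ∀ a, ∀ e : ℝ, |e| < r → μ a + e ∈ F.means := by
    intro a e he
    have : Function.update μ a (μ a + e) ∈ Metric.ball μ r := by
      rw [Metric.mem_ball, dist_pi_lt_iff hr]
      intro b
      by_cases h : b = a
      · subst h; simpa [Real.dist_eq] using he
      · rw [Function.update_of_ne h, dist_self]; exact hr
    have h2 := P.cell_subset i _ (hball this).2 a
    simpa using h2
  set ε := r / 2 with hε
  have hε0 : 0 < ε := by positivity
  have hp : ∀ a, μ a + ε ∈ F.means := fun a => hmem a ε (by rw [abs_of_pos hε0]; linarith)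
  have hm : ∀ a, μ a + -ε ∈ F.means := fun a =>
    hmem a (-ε) (by rw [abs_neg, abs_of_pos hε0]; linarith)
  -- For `e > 0` this is the event of an upper deviation by at least `e`, for `e < 0` of a lower
  -- deviation by at least `|e|`.
  let D : ℕ → Fin K → ℝ → Set (ℕ → Fin K × ℝ) := fun t a e =>
    {ω | 0 ≤ (F.natParam (μ a + e) - F.natParam (μ a)) * (empMean ω t a - (μ a + e))}
  have hDm : ∀ t a e, MeasurableSet (D t a e) := by
    intro t a e
    refine measurableSet_le measurable_const (measurable_const.mul (Measurable.sub_const ?_ _))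
    exact (measurable_pi_apply a).comp (measurable_empMean t)
  have hDt : ∀ a e, e ≠ 0 → μ a + e ∈ F.means →
      ∑' t : ℕ, ∫⁻ ω, (D t a e).indicator (fun _ => (t : ℝ≥0∞) + 1) ω ∂(P.law π μ) ≠ ∞ := by
    intro a e he hmem
    refine ne_top_of_le_ne_top (tsum_mul_exp_sqrt_ne_top
      (F.bregman_pos hmem (hμm a) (by simpa using he)) (K + 1)) ?_
    refine ENNReal.tsum_le_tsum fun t => ?_
    rw [lintegral_indicator_const (hDm t a e)]
    gcongr
    exact law_deviation_le hπ hcont hμm hmem a t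
  have hmeas : ∀ e, Measurable fun ω => ∑ a, ∑' t : ℕ,
      (D t a e).indicator (fun _ => (t : ℝ≥0∞) + 1) ω := fun e =>
    Finset.measurable_sum _ fun a _ => Measurable.tsum fun t =>
      measurable_const.indicator (hDm t a e)
  have hint : ∀ e, e ≠ 0 → (∀ a, μ a + e ∈ F.means) → ∫⁻ ω, ∑ a, ∑' t : ℕ,
      (D t a e).indicator (fun _ => (t : ℝ≥0∞) + 1) ω ∂(P.law π μ) ≠ ∞ := by
    intro e he hmem
    rw [lintegral_finsetSum _ fun a _ => Measurable.tsum fun t =>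
      measurable_const.indicator (hDm t a e)]
    refine ENNReal.sum_ne_top.2 fun a _ => ?_
    rw [lintegral_tsum fun t => (measurable_const.indicator (hDm t a e)).aemeasurable]
    exact hDt a e he (hmem a)
  have hle : ∀ e ω t a, ω ∈ D t a e → (t : ℝ≥0∞) + 1 ≤ ∑ a, ∑' t : ℕ,
      (D t a e).indicator (fun _ => (t : ℝ≥0∞) + 1) ω := by
    intro e ω t a h
    calc (t : ℝ≥0∞) + 1 = (D t a e).indicator (fun _ => (t : ℝ≥0∞) + 1) ω :=
          (indicator_of_mem h (fun _ => (t : ℝ≥0∞) + 1)).symm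
      _ ≤ ∑' t : ℕ, (D t a e).indicator (fun _ => (t : ℝ≥0∞) + 1) ω :=
          ENNReal.le_tsum (f := fun t : ℕ => (D t a e).indicator (fun _ => (t : ℝ≥0∞) + 1) ω) t
      _ ≤ _ := Finset.single_le_sum (f := fun a => ∑' t : ℕ,
          (D t a e).indicator (fun _ => (t : ℝ≥0∞) + 1) ω) (fun _ _ => zero_le) (Finset.mem_univ a)
  -- Summing `t + 1` over all deviation events dominates `t + 1` at each exit time `t`, the last one
  -- included, and has finite expectation by `tsum_mul_exp_sqrt_ne_top`.
  refine ⟨fun ω => (∑ a, ∑' t : ℕ, (D t a ε).indicator (fun _ => (t : ℝ≥0∞) + 1) ω) +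
    ∑ a, ∑' t : ℕ, (D t a (-ε)).indicator (fun _ => (t : ℝ≥0∞) + 1) ω, ?_,
    (hmeas ε).add (hmeas (-ε)), ?_⟩
  · rw [lintegral_add_left (hmeas ε)]
    exact ENNReal.add_ne_top.2 ⟨hint ε hε0.ne' hp, hint (-ε) (neg_ne_zero.2 hε0.ne') hm⟩
  · intro ω t hout
    have : ∃ a, ε ≤ |empMean ω t a - μ a| := by
      by_contra! hcon
      refine hout (hball ?_).1
      rw [Metric.mem_ball, dist_pi_lt_iff hr]
      intro a
      rw [Real.dist_eq]
      linarith [hcon a]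
    obtain ⟨a, ha⟩ := this
    rcases le_abs'.1 ha with h | h
    · refine (hle (-ε) ω t a ?_).trans le_add_self
      have h1 := F.strictMonoOn_natParam (hm a) (hμm a) (by linarith)
      change 0 ≤ (F.natParam (μ a + -ε) - F.natParam (μ a)) * (empMean ω t a - (μ a + -ε))
      exact mul_nonneg_of_nonpos_of_nonpos (by linarith) (by linarith)
    · refine (hle ε ω t a ?_).trans le_self_add
      have h1 := F.strictMonoOn_natParam (hμm a) (hp a) (by linarith)
      change 0 ≤ (F.natParam (μ a + ε) - F.natParam (μ a)) * (empMean ω t a - (μ a + ε))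
      exact mul_nonneg (by linarith) (by linarith)

end Concentration

/-! ### Linear growth of the statistic near the true means -/

section Continuity

lemma sum_mul_d_eq {i : Fin M} {x lam : Fin K → ℝ} (hx : x ∈ P.cell i) (hlam : lam ∈ P.alt x)
    {n : Fin K → ℝ} (hn : ∀ a, 0 ≤ n a) :
    ∑ a, ENNReal.ofReal (n a) * F.d (x a) (lam a) =
      ENNReal.ofReal (∑ a, n a * F.bregman (x a) (lam a)) := by
  rw [ENNReal.ofReal_sum_of_nonneg fun a _ => mul_nonneg (hn a) (F.bregman_nonneg
    (P.cell_subset i x hx a) (P.mem_means_of_mem_alt hlam a))]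
  refine Finset.sum_congr rfl fun a _ => ?_
  rw [F.d_eq (P.mem_interior_means hx a) (P.mem_means_of_mem_alt hlam a), ENNReal.ofReal_mul (hn a)]

/-- If the sampling proportions almost dominate `w` and `x` is close to `μ`, then the normalized
statistic at `x` is almost as large as `value μ w`. -/
lemma exists_nhds_le_iInf {i : Fin M} {μ : Fin K → ℝ} (hμ : μ ∈ P.cell i) {w : Fin K → ℝ}
    (hw : w ∈ stdSimplex ℝ (Fin K)) {v : ℝ} (hv0 : 0 ≤ v)
    (hv : ENNReal.ofReal v < P.value μ w) :
    ∃ κ > 0, ∃ U ∈ 𝓝 μ, U ⊆ P.cell i ∧ ∀ x ∈ U, ∀ t : ℕ, ∀ n : Fin K → ℕ,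
      (∀ a, (1 - κ) * (t * w a) ≤ n a) →
      ENNReal.ofReal (t * v) ≤ ⨅ lam ∈ P.alt x, ∑ a, (n a : ℝ≥0∞) * F.d (x a) (lam a) := by
  obtain ⟨v', hv', hv'V⟩ := ENNReal.lt_iff_exists_nnreal_btwn.1 hv
  have hvv' : v < v' := by
    rw [← ENNReal.ofReal_coe_nnreal] at hv'
    exact (ENNReal.ofReal_lt_ofReal_iff_of_nonneg hv0).1 hv'
  have hv'0 : (0 : ℝ) ≤ v' := v'.2
  -- Chosen so that `(1 - κ) * ((1 - κ) * v' - κ) ≥ v' - κ * (2 * v' + 1) ≥ v`: one factor `1 - κ`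
  -- is lost on the proportions, the other and the offset `κ` on the divergence.
  set κ := min (1 / 2) ((v' - v) / (2 * v' + 1)) with hκ
  have hκ0 : 0 < κ := lt_min (by norm_num) (div_pos (by linarith) (by linarith))
  have hκ1 : κ ≤ 1 / 2 := min_le_left _ _
  have hκ2 : κ * (2 * v' + 1) ≤ v' - v := by
    rw [← le_div_iff₀ (by linarith)]; exact min_le_right _ _
  have hcell := (P.isOpen_cell i).mem_nhds hμ
  have hev : ∀ᶠ x in 𝓝 μ, ∀ a, ∀ y ∈ F.means,
      (1 - κ) * F.bregman (μ a) y - κ ≤ F.bregman (x a) y := by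
    refine eventually_all.2 fun a => ?_
    exact (continuous_apply a).continuousAt.eventually
      (F.eventually_bregman_ge (P.mem_interior_means hμ a) hκ0)
  refine ⟨κ, hκ0, _, inter_mem hcell hev, inter_subset_left, ?_⟩
  rintro x ⟨hx, hxb⟩ t n hn
  refine le_iInf₂ fun lam hlam => ?_
  have hlam' : lam ∈ P.alt μ := by rwa [P.alt_eq hμ hx]
  have hS : (v' : ℝ) ≤ ∑ a, w a * F.bregman (μ a) (lam a) := by
    have h1 : P.value μ w ≤ ∑ a, ENNReal.ofReal (w a) * F.d (μ a) (lam a) := iInf₂_le lam hlam'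
    rw [sum_mul_d_eq hμ hlam' hw.1] at h1
    have h2 := hv'V.trans_le h1
    rw [← ENNReal.ofReal_coe_nnreal] at h2
    exact (ENNReal.ofReal_lt_ofReal_iff_of_nonneg hv'0).1 h2 |>.le
  have hsum : ∑ a, (n a : ℝ≥0∞) * F.d (x a) (lam a) =
      ENNReal.ofReal (∑ a, (n a : ℝ) * F.bregman (x a) (lam a)) := by
    rw [← sum_mul_d_eq hx hlam fun a => Nat.cast_nonneg (n a)]
    simp
  rw [hsum]
  refine ENNReal.ofReal_le_ofReal ?_
  have ht0 : (0 : ℝ) ≤ t := t.cast_nonneg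
  calc (t : ℝ) * v ≤ (1 - κ) * t * ((1 - κ) * ∑ a, w a * F.bregman (μ a) (lam a) - κ) := by
        have h1 : v ≤ (1 - κ) * ((1 - κ) * v' - κ) := by nlinarith
        have h2 : (1 - κ) * ((1 - κ) * v' - κ) ≤
            (1 - κ) * ((1 - κ) * ∑ a, w a * F.bregman (μ a) (lam a) - κ) := by
          have : 0 ≤ 1 - κ := by linarith
          gcongr
        calc (t : ℝ) * v ≤ t * ((1 - κ) * ((1 - κ) * ∑ a, w a * F.bregman (μ a) (lam a) - κ)) :=
              mul_le_mul_of_nonneg_left (h1.trans h2) ht0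
          _ = _ := by ring
    _ = ∑ a, (1 - κ) * (t * w a) * ((1 - κ) * F.bregman (μ a) (lam a) - κ) := by
        have h1 : ∑ a, (1 - κ) * (t * w a) * ((1 - κ) * F.bregman (μ a) (lam a) - κ) =
            (1 - κ) * t * (1 - κ) * ∑ a, w a * F.bregman (μ a) (lam a) -
              (1 - κ) * t * κ * ∑ a, w a := by
          rw [Finset.mul_sum, Finset.mul_sum, ← Finset.sum_sub_distrib]
          exact Finset.sum_congr rfl fun a _ => by ring
        rw [h1, hw.2]; ring
    _ ≤ ∑ a, (n a : ℝ) * F.bregman (x a) (lam a) := by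
        refine Finset.sum_le_sum fun a _ => ?_
        have hlm := P.mem_means_of_mem_alt hlam a
        have h0 : 0 ≤ (1 - κ) * (t * w a) :=
          mul_nonneg (by linarith) (mul_nonneg ht0 (hw.1 a))
        calc (1 - κ) * (t * w a) * ((1 - κ) * F.bregman (μ a) (lam a) - κ) ≤
            (1 - κ) * (t * w a) * F.bregman (x a) (lam a) :=
              mul_le_mul_of_nonneg_left (hxb a _ hlm) h0
          _ ≤ _ := mul_le_mul_of_nonneg_right (hn a)
              (F.bregman_nonneg (P.cell_subset i x hx a) hlm)

lemma optWeights_isOptimal (huniq : ∀ μ ∈ P.domain, ∃! w, P.IsOptimalWeights μ w)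
    {μ : Fin K → ℝ} (hμ : μ ∈ P.domain) : P.IsOptimalWeights μ (P.optWeights μ) :=
  Classical.epsilon_spec (huniq μ hμ).exists

lemma complexity_eq {μ w : Fin K → ℝ} (hw : P.IsOptimalWeights μ w) :
    P.complexity μ = (P.value μ w)⁻¹ := by
  rw [complexity]
  congr 1
  exact le_antisymm (iSup₂_le hw.2) (le_iSup₂_of_le w hw.1 le_rfl)

/-- Once the empirical means stay close to `μ`, the statistic grows at least at rate `v`. -/
lemma exists_glr_ge (huniq : ∀ μ ∈ P.domain, ∃! w, P.IsOptimalWeights μ w)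
    (hcont : ∀ i, ContinuousOn P.optWeights (P.cell i)) {i : Fin M} {μ : Fin K → ℝ}
    (hμ : μ ∈ P.cell i) {v : ℝ} (hv0 : 0 ≤ v)
    (hv : ENNReal.ofReal v < P.value μ (P.optWeights μ)) :
    ∃ U ∈ 𝓝 μ, ∃ A B : ℕ, ∀ ω : ℕ → Fin K × ℝ, (∀ t, (ω t).1 ∈ P.trackingArms ω t) →
      ∀ t₁ : ℕ, (∀ t ≥ t₁, empMean ω t ∈ U) →
        ∀ t, A * t₁ + B ≤ t → ENNReal.ofReal (t * v) ≤ P.glr ω t := by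
  have hdom : ∀ {x}, x ∈ P.cell i → x ∈ P.domain := fun hx => mem_iUnion.2 ⟨i, hx⟩
  set w := P.optWeights μ with hw
  have hwS : w ∈ stdSimplex ℝ (Fin K) := (optWeights_isOptimal huniq (hdom hμ)).1
  obtain ⟨κ, hκ, U, hU, hUcell, hUglr⟩ := exists_nhds_le_iInf hμ hwS hv0 hv
  -- The tracking error will be at most `2 * K * ε * t`, to be absorbed by a fraction `κ` of `t * w
  -- a`. Arms with `w a = 0` require no pulls, so only finitely many positive bounds on `ε` arise.
  obtain ⟨ε, hε, hεw⟩ : ∃ ε > 0, ∀ a, 0 < w a → 2 * K * ε ≤ κ * w a := by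
    have : ∀ᶠ ε : ℝ in 𝓝[>] 0, ∀ a, 0 < w a → 2 * K * ε ≤ κ * w a := by
      refine nhdsWithin_le_nhds (eventually_all.2 fun a => ?_)
      by_cases ha : 0 < w a
      · have hc : ContinuousAt (fun ε : ℝ => 2 * K * ε) 0 := by fun_prop
        filter_upwards [hc.eventually (gt_mem_nhds (show 2 * K * 0 < κ * w a by
          simpa using mul_pos hκ ha))]
          with ε hε _
        exact hε.le
      · exact Eventually.of_forall fun _ h => absurd h ha
    obtain ⟨ε, h1, h2⟩ := (this.and self_mem_nhdsWithin).exists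
    exact ⟨ε, h2, h1⟩
  have hclose : ∀ᶠ x in 𝓝 μ, ∀ a, P.optWeights x a < w a + ε := by
    refine eventually_all.2 fun a => ?_
    have hc := (hcont i).continuousAt ((P.isOpen_cell i).mem_nhds hμ)
    exact ((continuous_apply a).continuousAt.comp hc).eventually (gt_mem_nhds (by simp [hw, hε]))
  set E := ⌈1 / ε ^ 2⌉₊ with hE
  -- `⌈1 / ε⌉₊` makes `t₁ + E + 1 ≤ t * ε`, where `E` is the delay required by `mul_sub_le_pulls`;
  -- `(K + 2) ^ 2` forces every arm to have been pulled. The delay must be affine in `t₁` so that it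
  -- stays integrable.
  refine ⟨_, inter_mem hU hclose, ⌈1 / ε⌉₊, ⌈1 / ε⌉₊ * (E + 1) + (K + 2) ^ 2 + E + 1, ?_⟩
  intro ω hω t₁ hin t ht
  have hA1 : 1 ≤ ⌈1 / ε⌉₊ := Nat.one_le_ceil_iff.2 (by positivity)
  have htge : t₁ + E ≤ t := by nlinarith
  have h1 : (1 / ε) * ((t₁ + E : ℕ) + 1) ≤ (t : ℝ) := by
    calc (1 / ε) * ((t₁ + E : ℕ) + 1) ≤ (⌈1 / ε⌉₊ : ℝ) * ((t₁ + E : ℕ) + 1) := by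
          gcongr; exact Nat.le_ceil _
      _ = ((⌈1 / ε⌉₊ * (t₁ + E + 1) : ℕ) : ℝ) := by push_cast; ring
      _ ≤ (t : ℝ) := by
          refine Nat.cast_le.2 ?_
          nlinarith
  have h1' : ((t₁ + E : ℕ) : ℝ) + 1 ≤ t * ε := by
    rw [one_div, inv_mul_le_iff₀ hε] at h1
    linarith
  have htr := mul_sub_le_pulls hω hwS hε (t₀ := t₁ + E)
    ((Nat.le_ceil _).trans (by push_cast; linarith [(Nat.cast_nonneg t₁ : (0 : ℝ) ≤ t₁)]))
    (fun s hs => by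
      obtain ⟨hs1, hs2⟩ := hin s (by omega)
      exact ⟨hdom (hUcell hs1), (optWeights_isOptimal huniq (hdom (hUcell hs1))).1,
        fun a => (hs2 a).le⟩) htge
  have hpulls : ∀ a, (1 - κ) * (t * w a) ≤ pulls ω a t := by
    intro a
    rcases (hwS.1 a).eq_or_lt' with h0 | hpos
    · rw [h0]; simp
    · refine le_trans ?_ (htr a)
      have h2 : (K : ℝ) * ((t₁ + E : ℕ) + t * ε + 1) ≤ K * (2 * (t * ε)) := by
        gcongr; linarith
      have h3 : (t : ℝ) * (2 * K * ε) ≤ t * (κ * w a) :=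
        mul_le_mul_of_nonneg_left (hεw a hpos) t.cast_nonneg
      nlinarith
  have hxt := (hin t (by omega)).1
  have hrec : P.Recommends ω t i := by
    refine ⟨fun a h0 => ?_, hUcell hxt⟩
    have h2 := sqrt_sub_le_pulls hω t a
    rw [h0] at h2
    have h3 : ((K : ℝ) + 2) ≤ √(t : ℝ) := by
      refine Real.le_sqrt_of_sq_le ?_
      have : (K + 2) ^ 2 ≤ t := by nlinarith
      exact_mod_cast this
    push_cast at h2
    linarith
  rw [glr, if_pos ⟨i, hrec⟩]
  exact hUglr _ hxt t (fun a => pulls ω a t) hpulls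

end Continuity

/-! ### Upper bound on the expected sample complexity -/

section UpperBound

/-- The point is that `B` does not depend on `δ`: both the exit time and the time from which `log (D
* t)` is negligible are independent of it. -/
lemma exists_expectedTime_le (huniq : ∀ μ ∈ P.domain, ∃! w, P.IsOptimalWeights μ w)
    (hcont : ∀ i, ContinuousOn P.optWeights (P.cell i)) {c : ℕ → ℝ → ℝ} {C D : ℝ} (hD : 0 < D)
    (hc : ∀ t : ℕ, C ≤ t → ∀ δ ∈ Ioc (0 : ℝ) 1, c t δ ≤ Real.log (D * t / δ))
    {π : SamplingRule K} (hπ : P.IsTracking π) {μ : Fin K → ℝ} (hμ : μ ∈ P.domain)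
    {u : ℝ} (hu0 : 0 < u) (hu : ENNReal.ofReal u < P.value μ (P.optWeights μ)) :
    ∃ B : ℝ≥0∞, B ≠ ∞ ∧ ∀ δ ∈ Ioc (0 : ℝ) 1,
      P.expectedTime π (fun t => c t δ) μ ≤ B + ENNReal.ofReal (Real.log (1 / δ) / u) := by
  obtain ⟨i, hi⟩ := mem_iUnion.1 hμ
  obtain ⟨v, huv', hv'V⟩ := ENNReal.lt_iff_exists_nnreal_btwn.1 hu
  have huv : u < v := by
    rw [← ENNReal.ofReal_coe_nnreal] at huv'
    exact (ENNReal.ofReal_lt_ofReal_iff_of_nonneg hu0.le).1 huv'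
  rw [← ENNReal.ofReal_coe_nnreal] at hv'V
  obtain ⟨U, hU, A, B, hAB⟩ := exists_glr_ge huniq hcont hi v.2 hv'V
  obtain ⟨σ, hσint, hσm, hσ⟩ := exists_last_exit_bound hπ hcont hi hU
  -- The gap `v - u` pays for `log (D * t)`; beyond `T`, the threshold is below `t * v` as soon as
  -- `t > log (1 / δ) / u`.
  obtain ⟨T, hT⟩ : ∃ T : ℕ, ∀ t : ℕ, T ≤ t → C ≤ t ∧ 0 < t ∧ Real.log (D * t) ≤ (v - u) * t := by
    refine eventually_atTop.1 ?_
    have h1 : ∀ᶠ x : ℝ in atTop, Real.log x ≤ (v - u) / 2 * x := by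
      have := Real.isLittleO_log_id_atTop.bound (c := (v - u) / 2) (by linarith)
      filter_upwards [this, eventually_ge_atTop 0] with x hx hx0
      refine (le_abs_self _).trans (hx.trans_eq ?_)
      simp [abs_of_nonneg hx0]
    have h2 : ∀ᶠ x : ℝ in atTop, Real.log D ≤ (v - u) / 2 * x :=
      (tendsto_id.const_mul_atTop (show 0 < (v - u) / 2 by linarith)).eventually_ge_atTop _
    have h3 := (h1.and (h2.and (eventually_ge_atTop C)))
    filter_upwards [tendsto_natCast_atTop_atTop.eventually h3, eventually_gt_atTop 0]
      with t ⟨ht1, ht2, ht3⟩ ht0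
    refine ⟨ht3, ht0, ?_⟩
    rw [Real.log_mul hD.ne' (by positivity)]
    linarith
  refine ⟨(A : ℝ≥0∞) * ∫⁻ ω, σ ω ∂(P.law π μ) + (A + B + T + 2 : ℕ), ?_, ?_⟩
  · exact ENNReal.add_ne_top.2 ⟨ENNReal.mul_ne_top (by simp) hσint, by simp⟩
  intro δ hδ
  set L := Real.log (1 / δ) / u with hL
  have hlog : 0 ≤ Real.log (1 / δ) :=
    Real.log_nonneg (by rw [le_div_iff₀ hδ.1]; linarith [hδ.2])
  have hL0 : 0 ≤ L := div_nonneg hlog hu0.le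
  have hpath : ∀ᵐ ω ∂(P.law π μ), (P.stoppingTime (fun t => c t δ) ω : ℝ≥0∞) ≤
      (A : ℝ≥0∞) * σ ω + ((A + B + T + 2 : ℕ) + ENNReal.ofReal L) := by
    filter_upwards [hπ.ae_mem_trackingArms hcont fun a => F.dist (μ a),
      ae_lt_top hσm hσint] with ω hω hfin
    set t₁ := ⌈(σ ω).toReal⌉₊ with ht₁
    have hin : ∀ t ≥ t₁, empMean ω t ∈ U := by
      intro t ht
      by_contra hout
      have h1 := hσ ω t hout
      have h2 : (t : ℝ) + 1 ≤ (σ ω).toReal := by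
        have := ENNReal.toReal_mono hfin.ne h1
        rwa [ENNReal.toReal_add (by simp) (by simp), ENNReal.toReal_natCast,
          ENNReal.toReal_one] at this
      have h3 : (σ ω).toReal ≤ t := (Nat.le_ceil _).trans (by exact_mod_cast ht)
      linarith
    set t := A * t₁ + B + T + (⌈L⌉₊ + 1) with ht
    have hglr := hAB ω hω t₁ hin t (by omega)
    obtain ⟨hCt, ht0, hlogt⟩ := hT t (by omega)
    have hct := hc t hCt δ hδ
    have hlt : c t δ < t * v := by
      have h1 : Real.log (D * t / δ) = Real.log (D * t) + Real.log (1 / δ) := by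
        rw [← Real.log_mul (mul_pos hD (Nat.cast_pos.2 ht0)).ne' (one_div_pos.2 hδ.1).ne']
        congr 1; ring
      have h2 : L < t := by
        have h3 : L ≤ ⌈L⌉₊ := Nat.le_ceil _
        have h4 : ((⌈L⌉₊ + 1 : ℕ) : ℝ) ≤ t := by exact_mod_cast (by omega : ⌈L⌉₊ + 1 ≤ t)
        push_cast at h4
        linarith
      rw [hL, div_lt_iff₀ hu0] at h2
      linarith
    have hτ_le : P.stoppingTime (fun t => c t δ) ω ≤ t := by
      refine P.stoppingTime_le _ ?_
      refine lt_of_lt_of_le ?_ (EReal.coe_ennreal_le_coe_ennreal_iff.2 hglr)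
      rw [EReal.coe_ennreal_ofReal, max_eq_left (mul_nonneg t.cast_nonneg v.2)]
      exact EReal.coe_lt_coe_iff.2 hlt
    have hτ_cast : (P.stoppingTime (fun t => c t δ) ω : ℝ≥0∞) ≤ (t : ℝ≥0∞) := by
      have := ENat.toENNReal_le.2 hτ_le
      simpa using this
    refine hτ_cast.trans ?_
    have ht₁σ : (t₁ : ℝ≥0∞) ≤ σ ω + 1 := by
      have h1 : (t₁ : ℝ) ≤ (σ ω).toReal + 1 := (Nat.ceil_lt_add_one ENNReal.toReal_nonneg).le
      have h2 := ENNReal.ofReal_le_ofReal h1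
      rwa [ENNReal.ofReal_natCast, ENNReal.ofReal_add ENNReal.toReal_nonneg zero_le_one,
        ENNReal.ofReal_toReal hfin.ne, ENNReal.ofReal_one] at h2
    have hLc : (⌈L⌉₊ : ℝ≥0∞) ≤ ENNReal.ofReal L + 1 := by
      have h1 : (⌈L⌉₊ : ℝ) ≤ L + 1 := (Nat.ceil_lt_add_one hL0).le
      have h2 := ENNReal.ofReal_le_ofReal h1
      rwa [ENNReal.ofReal_natCast, ENNReal.ofReal_add hL0 zero_le_one, ENNReal.ofReal_one] at h2
    calc (t : ℝ≥0∞) = A * t₁ + B + T + (⌈L⌉₊ + 1) := by rw [ht]; push_cast; ring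
      _ ≤ A * (σ ω + 1) + B + T + (ENNReal.ofReal L + 1 + 1) := by gcongr
      _ = _ := by push_cast; ring
  calc P.expectedTime π (fun t => c t δ) μ ≤
      ∫⁻ ω, ((A : ℝ≥0∞) * σ ω + ((A + B + T + 2 : ℕ) + ENNReal.ofReal L)) ∂(P.law π μ) :=
        lintegral_mono_ae hpath
    _ = _ := by
      rw [lintegral_add_left (hσm.const_mul _), lintegral_const_mul _ hσm, lintegral_const,
        measure_univ, mul_one, ← add_assoc]

lemma tendsto_log_one_div : Tendsto (fun δ : ℝ => Real.log (1 / δ)) (𝓝[>] 0) atTop := by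
  simp only [one_div]
  exact Real.tendsto_log_atTop.comp tendsto_inv_nhdsGT_zero

/-- Any finite `r` above the complexity is admissible with `u = r⁻¹`, and the constant `B` vanishes
after division by `log (1 / δ)`. -/
lemma limsup_expectedTime_le (huniq : ∀ μ ∈ P.domain, ∃! w, P.IsOptimalWeights μ w)
    (hcont : ∀ i, ContinuousOn P.optWeights (P.cell i)) {c : ℕ → ℝ → ℝ} {C D : ℝ} (hD : 0 < D)
    (hc : ∀ t : ℕ, C ≤ t → ∀ δ ∈ Ioc (0 : ℝ) 1, c t δ ≤ Real.log (D * t / δ))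
    {π : SamplingRule K} (hπ : P.IsTracking π) {μ : Fin K → ℝ} (hμ : μ ∈ P.domain) :
    limsup (fun δ : ℝ => P.expectedTime π (fun t => c t δ) μ / ENNReal.ofReal (Real.log (1 / δ)))
      (𝓝[>] 0) ≤ P.complexity μ := by
  rw [complexity_eq (optWeights_isOptimal huniq hμ)]
  refine le_of_forall_gt_imp_ge_of_dense fun r hr => ?_
  rcases eq_or_ne r ∞ with rfl | hrt
  · exact le_top
  have hr0 : r ≠ 0 := (zero_le.trans_lt hr).ne'
  have hu0 : 0 < (r⁻¹).toReal :=
    ENNReal.toReal_pos (ENNReal.inv_ne_zero.2 hrt) (ENNReal.inv_ne_top.2 hr0)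
  have hur : ENNReal.ofReal (r⁻¹).toReal = r⁻¹ := ENNReal.ofReal_toReal (ENNReal.inv_ne_top.2 hr0)
  obtain ⟨B, hB, hle⟩ := exists_expectedTime_le huniq hcont hD hc hπ hμ hu0
    (by rw [hur]; exact ENNReal.inv_lt_iff_inv_lt.1 hr)
  have hlim : Tendsto (fun δ : ℝ => B / ENNReal.ofReal (Real.log (1 / δ)) + r) (𝓝[>] 0)
      (𝓝 (0 + r)) := by
    refine Tendsto.add ?_ tendsto_const_nhds
    have h1 := ENNReal.tendsto_ofReal_atTop.comp tendsto_log_one_div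
    have h2 := ENNReal.Tendsto.const_div h1 (Or.inr hB)
    simpa using h2
  rw [zero_add] at hlim
  rw [← hlim.limsup_eq]
  refine limsup_le_limsup ?_
  filter_upwards [Ioo_mem_nhdsGT (zero_lt_one' ℝ)] with δ hδ
  have hlog : 0 < Real.log (1 / δ) :=
    Real.log_pos (by rw [lt_div_iff₀ hδ.1]; linarith [hδ.2])
  refine (ENNReal.div_le_div_right (hle δ ⟨hδ.1, hδ.2.le⟩) _).trans_eq ?_
  rw [ENNReal.add_div, ENNReal.ofReal_div_of_pos hu0, hur]
  congr 1
  rw [div_eq_mul_inv, div_eq_mul_inv, inv_inv, mul_right_comm, ENNReal.mul_inv_cancel, one_mul]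
  · simpa using hlog
  · simp

end UpperBound

end IdentificationProblem

/-- The tail-sum formula, which expresses the expected stopping time through the events that it
exceeds `s`. -/
lemma ENat.toENNReal_eq_tsum (x : ℕ∞) :
    (x : ℝ≥0∞) = ∑' s : ℕ, if (s : ℕ∞) < x then 1 else 0 := by
  induction x using ENat.recTopCoe with
  | top => simp
  | coe n =>
    rw [tsum_eq_sum (s := Finset.range n)]
    · rw [Finset.sum_congr rfl (g := fun _ => 1) fun s hs => if_pos (by simpa using hs)]
      simp
    · intro s hs
      exact if_neg (by simpa using hs)

/-! ### Change of measure and Wald's identity at a bounded stopping time -/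

namespace ExpFamily

variable (F : ExpFamily) {K : ℕ}

section Stopped


lemma measurableSet_eq_of_lt {ρ : (ℕ → Fin K × ℝ) → ℕ} (hm : ∀ t, MeasurableSet {ω | t < ρ ω})
    (t : ℕ) : MeasurableSet {ω | ρ ω = t} := by
  have hle : MeasurableSet {ω | t ≤ ρ ω} := by
    cases t with
    | zero => simp
    | succ t => exact hm t
  have : {ω | ρ ω = t} = {ω | t ≤ ρ ω} \ {ω | t < ρ ω} := by
    ext ω; simp only [mem_ofPred_eq, Set.mem_sdiff, not_lt]; omega
  rw [this]
  exact hle.diff (hm t)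

lemma eq_iff_of_dependsOn {ρ : (ℕ → Fin K × ℝ) → ℕ}
    (hd : ∀ t, DependsOn (fun ω => t < ρ ω) (Iio t)) {t : ℕ} {ω ω' : ℕ → Fin K × ℝ}
    (h : ∀ s < t, ω s = ω' s) : ρ ω = t ↔ ρ ω' = t := by
  have h1 : (t < ρ ω) = (t < ρ ω') := hd t h
  have h2 : t ≤ ρ ω ↔ t ≤ ρ ω' := by
    cases t with
    | zero => simp
    | succ t =>
      have : (t < ρ ω) = (t < ρ ω') := hd t fun s hs => h s (Nat.lt_succ_of_lt hs)
      rw [Nat.succ_le_iff, Nat.succ_le_iff, this]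
  rw [eq_iff_iff] at h1
  omega

/-- Change of measure at a bounded stopping time. -/
lemma lintegral_law_mul_exp_logLik_stopped (π : SamplingRule K) {μ μ' : Fin K → ℝ}
    (hμ : ∀ a, μ a ∈ F.means) (hμ' : ∀ a, μ' a ∈ F.means) {ρ : (ℕ → Fin K × ℝ) → ℕ}
    (hm : ∀ t, MeasurableSet {ω | t < ρ ω}) {n : ℕ} (hn : ∀ ω, ρ ω ≤ n)
    {H : (ℕ → Fin K × ℝ) → ℝ≥0∞} (hH : Measurable H)
    (hHd : ∀ t, DependsOn ({ω | ρ ω = t}.indicator H) (Iio t)) :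
    ∫⁻ ω, H ω * ENNReal.ofReal (Real.exp (F.logLik μ' μ ω (ρ ω)))
        ∂(π.law fun a => F.dist (μ a)) =
      ∫⁻ ω, H ω ∂(π.law fun a => F.dist (μ' a)) := by
  have hind : ∀ t, Measurable ({ω | ρ ω = t}.indicator H) := fun t =>
    hH.indicator (measurableSet_eq_of_lt hm t)
  have hexp : ∀ t, Measurable fun ω => ENNReal.ofReal (Real.exp (F.logLik μ' μ ω t)) := fun t => by
    have := F.measurable_logLik μ' μ t
    fun_prop
  have h1 : ∀ e : ℕ → ℝ≥0∞, ∀ ω, H ω * e (ρ ω) =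
      ∑ t ∈ Finset.range (n + 1), {ω | ρ ω = t}.indicator H ω * e t := by
    intro e ω
    rw [Finset.sum_eq_single (ρ ω)]
    · rw [indicator_of_mem (by simp)]
    · intro t _ ht
      rw [indicator_of_notMem (by simpa using ht.symm), zero_mul]
    · intro h
      exact absurd (Finset.mem_range.2 (Nat.lt_succ_of_le (hn ω))) h
  have h2 : ∀ ω, H ω = ∑ t ∈ Finset.range (n + 1), {ω | ρ ω = t}.indicator H ω := by
    intro ω
    simpa using h1 (fun _ => 1) ω
  calc ∫⁻ ω, H ω * ENNReal.ofReal (Real.exp (F.logLik μ' μ ω (ρ ω)))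
        ∂(π.law fun a => F.dist (μ a))
      = ∫⁻ ω, ∑ t ∈ Finset.range (n + 1), {ω | ρ ω = t}.indicator H ω *
          ENNReal.ofReal (Real.exp (F.logLik μ' μ ω t)) ∂(π.law fun a => F.dist (μ a)) :=
        lintegral_congr fun ω => h1 (fun t => ENNReal.ofReal (Real.exp (F.logLik μ' μ ω t))) ω
    _ = ∑ t ∈ Finset.range (n + 1), ∫⁻ ω, {ω | ρ ω = t}.indicator H ω
          ∂(π.law fun a => F.dist (μ' a)) := by
        rw [lintegral_finsetSum (f := fun t ω => {ω | ρ ω = t}.indicator H ω *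
          ENNReal.ofReal (Real.exp (F.logLik μ' μ ω t))) _ fun t _ => (hind t).mul (hexp t)]
        exact Finset.sum_congr rfl fun t _ =>
          F.lintegral_law_mul_exp_logLik π hμ hμ' (hind t) (hHd t)
    _ = ∫⁻ ω, H ω ∂(π.law fun a => F.dist (μ' a)) := by
        rw [← lintegral_finsetSum _ fun t _ => hind t]
        exact lintegral_congr fun ω => (h2 ω).symm

/-- Wald's identity for the log-likelihood ratio at a bounded stopping time. -/
lemma integral_logLik_stopped (π : SamplingRule K) {μ : Fin K → ℝ} (μ' : Fin K → ℝ)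
    (hμ : ∀ a, μ a ∈ interior F.means) {ρ : (ℕ → Fin K × ℝ) → ℕ}
    (hm : ∀ t, MeasurableSet {ω | t < ρ ω}) (hd : ∀ t, DependsOn (fun ω => t < ρ ω) (Iio t))
    {n : ℕ} (hn : ∀ ω, ρ ω ≤ n) :
    Integrable (fun ω => F.logLik μ μ' ω (ρ ω)) (π.law fun a => F.dist (μ a)) ∧
    ∫ ω, F.logLik μ μ' ω (ρ ω) ∂(π.law fun a => F.dist (μ a)) =
      ∑ a, (∑ s ∈ Finset.range n, (π.law fun a => F.dist (μ a)).real
        ({ω | s < ρ ω} ∩ {ω | (ω s).1 = a})) * F.bregman (μ a) (μ' a) := by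
  set Q := π.law fun a => F.dist (μ a) with hQ
  let B : ℕ → Fin K → Set (ℕ → Fin K × ℝ) := fun s a => {ω | s < ρ ω} ∩ {ω | (ω s).1 = a}
  have hBm : ∀ s a, MeasurableSet (B s a) := fun s a => (hm s).inter (measurableSet_arm_eq s a)
  let g : ℕ → Fin K → (ℕ → Fin K × ℝ) → ℝ := fun s a =>
    (B s a).indicator fun ω => F.logRatio (μ a) (μ' a) (ω s).2
  have hsum : ∀ ω, F.logLik μ μ' ω (ρ ω) = ∑ s ∈ Finset.range n, ∑ a, g s a ω := by
    intro ω
    have h1 : ∀ s, ∑ a, g s a ω =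
        if s < ρ ω then F.logRatio (μ (ω s).1) (μ' (ω s).1) (ω s).2 else 0 := by
      intro s
      by_cases hs : s < ρ ω
      · rw [if_pos hs, Finset.sum_eq_single (ω s).1]
        · exact indicator_of_mem (show ω ∈ B s (ω s).1 from ⟨hs, rfl⟩) _
        · intro a _ ha
          exact indicator_of_notMem (fun h : ω ∈ B s a => ha h.2.symm) _
        · simp
      · rw [if_neg hs]
        exact Finset.sum_eq_zero fun a _ => indicator_of_notMem (fun h : ω ∈ B s a => hs h.1) _
    simp only [h1]
    rw [← Finset.sum_filter, logLik]
    congr 1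
    ext s
    simp only [Finset.mem_range, Finset.mem_filter]
    have := hn ω
    omega
  have hg : ∀ s a, Integrable (g s a) Q ∧
      ∫ ω, g s a ω ∂Q = Q.real (B s a) * F.bregman (μ a) (μ' a) := by
    intro s a
    -- Whether `s < ρ` is decided by the first `s` rounds, so the next observation still has the law
    -- of the selected arm on this event.
    have hmap := π.map_restrict_law (fun a => F.dist (μ a)) (t := s) (hm s) (hd s) a
    have hX : Measurable fun ω : ℕ → Fin K × ℝ => (ω s).2 := by fun_prop
    have hl := F.measurable_logRatio (μ a) (μ' a)
    have hi : Integrable (F.logRatio (μ a) (μ' a)) ((Q.restrict (B s a)).map fun ω => (ω s).2) := by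
      rw [hmap]
      exact (F.integrable_logRatio (hμ a) _).smul_measure (measure_ne_top _ _)
    constructor
    · rw [integrable_indicator_iff (hBm s a)]
      exact hi.comp_measurable hX
    · rw [integral_indicator (hBm s a),
        ← integral_map (φ := fun ω : ℕ → Fin K × ℝ => (ω s).2) hX.aemeasurable
        (f := F.logRatio (μ a) (μ' a)) hl.aestronglyMeasurable, hmap, integral_smul_measure,
        F.integral_logRatio (hμ a), smul_eq_mul]
      rfl
  simp only [hsum]
  refine ⟨integrable_finsetSum _ fun s _ => integrable_finsetSum _ fun a _ => (hg s a).1, ?_⟩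
  rw [integral_finsetSum _ fun s _ => integrable_finsetSum _ fun a _ => (hg s a).1]
  simp only [integral_finsetSum _ fun a _ => (hg _ a).1, (hg _ _).2]
  rw [Finset.sum_comm]
  exact Finset.sum_congr rfl fun a _ => (Finset.sum_mul _ _ _).symm

end Stopped

end ExpFamily

namespace IdentificationProblem

variable {F : ExpFamily} {K M : ℕ} {P : IdentificationProblem F K M}

/-! ### Lower bound for correct strategies -/

section LowerBound

/-- The stopping time truncated at `n`. -/
def truncatedTime (P : IdentificationProblem F K M) (c : ℕ → ℝ) (n : ℕ) (ω : ℕ → Fin K × ℝ) : ℕ :=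
  (min (P.stoppingTime c ω) n).toNat

variable {c : ℕ → ℝ} {n : ℕ}

lemma coe_truncatedTime (ω : ℕ → Fin K × ℝ) :
    (P.truncatedTime c n ω : ℕ∞) = min (P.stoppingTime c ω) n :=
  ENat.natCast_toNat (ne_top_of_le_ne_top (ENat.natCast_ne_top n) (min_le_right _ _))

lemma lt_truncatedTime_iff {ω : ℕ → Fin K × ℝ} {t : ℕ} :
    t < P.truncatedTime c n ω ↔ (t : ℕ∞) < P.stoppingTime c ω ∧ t < n := by
  rw [← ENat.natCast_lt_natCast, coe_truncatedTime, lt_min_iff, ENat.natCast_lt_natCast]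

lemma truncatedTime_le (ω : ℕ → Fin K × ℝ) : P.truncatedTime c n ω ≤ n := by
  have := (coe_truncatedTime (P := P) (c := c) (n := n) ω).trans_le (min_le_right _ _)
  exact_mod_cast this

lemma truncatedTime_eq {ω : ℕ → Fin K × ℝ} (h : P.stoppingTime c ω ≤ n) :
    P.stoppingTime c ω = P.truncatedTime c n ω := by
  rw [coe_truncatedTime, min_eq_left h]

lemma measurableSet_lt_truncatedTime (t : ℕ) :
    MeasurableSet {ω | t < P.truncatedTime c n ω} := by
  simp only [lt_truncatedTime_iff]
  exact (P.measurableSet_lt_stoppingTime c t).inter (MeasurableSet.const _)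

lemma dependsOn_lt_truncatedTime (t : ℕ) :
    DependsOn (fun ω => t < P.truncatedTime c n ω) (Iio t) := by
  intro ω ω' h
  simp only [lt_truncatedTime_iff, P.lt_stoppingTime_congr c h]

lemma measurable_stoppingTime : Measurable fun ω => (P.stoppingTime c ω : ℝ≥0∞) := by
  simp only [ENat.toENNReal_eq_tsum]
  exact Measurable.tsum fun s =>
    Measurable.ite (P.measurableSet_lt_stoppingTime c s) measurable_const measurable_const

lemma sum_measure_lt_stoppingTime_le (π : SamplingRule K) (μ : Fin K → ℝ) :
    ∑ s ∈ Finset.range n, P.law π μ {ω | (s : ℕ∞) < P.stoppingTime c ω} ≤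
      P.expectedTime π c μ := by
  rw [expectedTime]
  simp only [ENat.toENNReal_eq_tsum]
  rw [lintegral_tsum fun s => (Measurable.ite (P.measurableSet_lt_stoppingTime c s)
    measurable_const measurable_const).aemeasurable]
  refine le_trans (le_of_eq (Finset.sum_congr rfl fun s _ => ?_)) (ENNReal.sum_le_tsum _)
  rw [← lintegral_indicator_one (P.measurableSet_lt_stoppingTime c s)]
  refine lintegral_congr fun ω => ?_
  by_cases h : (s : ℕ∞) < P.stoppingTime c ω
  · rw [indicator_of_mem (by exact h), if_pos h]; rfl
  · rw [indicator_of_notMem (by exact h), if_neg h]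

/-- The event that the strategy stops by time `n` and recommends the cell `i`. -/
def stopsWith (P : IdentificationProblem F K M) (c : ℕ → ℝ) (i : Fin M) (n : ℕ) :
    Set (ℕ → Fin K × ℝ) :=
  {ω | ¬ (n : ℕ∞) < P.stoppingTime c ω ∧ P.Recommends ω (P.truncatedTime c n ω) i}

lemma measurableSet_stopsWith (i : Fin M) : MeasurableSet (P.stopsWith c i n) := by
  have : P.stopsWith c i n = {ω | (n : ℕ∞) < P.stoppingTime c ω}ᶜ ∩
      ⋃ t, ({ω | P.truncatedTime c n ω = t} ∩ {ω | P.Recommends ω t i}) := by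
    ext ω; simp [stopsWith]
  rw [this]
  exact (P.measurableSet_lt_stoppingTime c n).compl.inter (.iUnion fun t =>
    (ExpFamily.measurableSet_eq_of_lt measurableSet_lt_truncatedTime t).inter
      (P.measurableSet_recommends t i))

/-- Membership is decided by the rounds up to the truncated time, as the stopped change of measure
requires. When that time is `n`, stopping exactly at `n` and not having stopped must be
distinguished, which the first `n` rounds suffice to do. -/
lemma mem_stopsWith_congr {i : Fin M} {t : ℕ} {ω ω' : ℕ → Fin K × ℝ} (h : ∀ s < t, ω s = ω' s)
    (hω : P.truncatedTime c n ω = t) : ω ∈ P.stopsWith c i n ↔ ω' ∈ P.stopsWith c i n := by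
  have hω' := (ExpFamily.eq_iff_of_dependsOn dependsOn_lt_truncatedTime h).1 hω
  have key : ∀ ω : ℕ → Fin K × ℝ, P.truncatedTime c n ω = t → t < n →
      ¬ (n : ℕ∞) < P.stoppingTime c ω := by
    intro ω hω htn hlt
    have := coe_truncatedTime (P := P) (c := c) (n := n) ω
    rw [min_eq_right hlt.le, hω] at this
    exact htn.ne (by exact_mod_cast this)
  simp only [stopsWith, mem_ofPred_eq, hω, hω', P.recommends_congr h]
  rcases (hω ▸ truncatedTime_le ω : t ≤ n).lt_or_eq with htn | rfl
  · simp only [key ω hω htn, key ω' hω' htn]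
  · rw [P.lt_stoppingTime_congr c h]

/-- The transportation inequality. -/
lemma log_mul_sub_le {π : SamplingRule K} {δ : ℝ} (hδ : δ ∈ Ioc (0 : ℝ) 1)
    (hcorr : P.IsCorrect π c δ) {i : Fin M} {μ lam : Fin K → ℝ} (hμ : μ ∈ P.cell i)
    (hlam : lam ∈ P.alt μ) :
    Real.log (1 / δ) * (P.law π μ).real (P.stopsWith c i n) - 2 ≤
      ∑ a, (∑ s ∈ Finset.range n, (P.law π μ).real
        ({ω | s < P.truncatedTime c n ω} ∩ {ω | (ω s).1 = a})) * F.bregman (μ a) (lam a) := by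
  obtain ⟨j, hji, hj⟩ := (P.mem_alt_iff hμ).1 hlam
  set ρ := P.truncatedTime c n with hρ
  set E := P.stopsWith c i n with hE
  have hEm : MeasurableSet E := measurableSet_stopsWith i
  obtain ⟨hint, heq⟩ := F.integral_logLik_stopped π lam (P.mem_interior_means hμ)
    (ρ := ρ) measurableSet_lt_truncatedTime dependsOn_lt_truncatedTime (n := n) truncatedTime_le
  change Integrable _ (P.law π μ) at hint
  change ∫ ω, _ ∂(P.law π μ) = _ at heq
  -- On `E` the weight `1 / δ` compensates the error probability under `lam`, so `H` has mean at
  -- most `1 + 1` there. It also dominates `exp` of the indicator of `E` times `log (1 / δ)`.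
  set H : (ℕ → Fin K × ℝ) → ℝ≥0∞ := fun ω =>
    1 + E.indicator (fun _ => ENNReal.ofReal (1 / δ)) ω with hH
  have hHm : Measurable H :=
    (measurable_const.indicator (f := fun _ => ENNReal.ofReal (1 / δ)) hEm).const_add 1
  have hchange := F.lintegral_law_mul_exp_logLik_stopped π (P.cell_subset i μ hμ)
    (P.cell_subset j lam hj) (ρ := ρ) measurableSet_lt_truncatedTime truncatedTime_le hHm
    (fun t ω ω' h => by
      have h1 := ExpFamily.eq_iff_of_dependsOn (ρ := ρ) dependsOn_lt_truncatedTime h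
      by_cases ht : ρ ω = t
      · rw [indicator_of_mem (by exact ht), indicator_of_mem (by exact h1.1 ht)]
        have h2 := mem_stopsWith_congr (i := i) h ht
        simp only [hH]
        congr 1
        by_cases h3 : ω ∈ E
        · rw [indicator_of_mem h3, indicator_of_mem (h2.1 h3)]
        · rw [indicator_of_notMem h3, indicator_of_notMem (mt h2.2 h3)]
      · rw [indicator_of_notMem (by exact ht), indicator_of_notMem (by exact mt h1.2 ht)])
  change ∫⁻ ω, _ ∂(P.law π μ) = ∫⁻ ω, _ ∂(P.law π lam) at hchange
  have hbound : ∫⁻ ω, H ω ∂(P.law π lam) ≤ 2 := by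
    rw [hH, lintegral_add_left measurable_const, lintegral_indicator_const hEm, lintegral_const,
      measure_univ, mul_one, ← one_add_one_eq_two]
    gcongr
    have hsub : E ⊆ {ω | ∃ t : ℕ, P.stoppingTime c ω = t ∧ ¬ P.Recommends ω t j} := by
      rintro ω ⟨h1, h2⟩
      exact ⟨_, truncatedTime_eq (not_lt.1 h1), fun h3 =>
        hji ((P.mem_cell_iff h2.2).1 h3.2)⟩
    calc ENNReal.ofReal (1 / δ) * P.law π lam E ≤ ENNReal.ofReal (1 / δ) * ENNReal.ofReal δ := by
          gcongr
          exact (measure_mono hsub).trans (hcorr j lam hj)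
      _ = 1 := by
          rw [← ENNReal.ofReal_mul (one_div_pos.2 hδ.1).le, one_div_mul_cancel hδ.1.ne',
            ENNReal.ofReal_one]
  set f : (ℕ → Fin K × ℝ) → ℝ := fun ω =>
    E.indicator (fun _ => Real.log (1 / δ)) ω - F.logLik μ lam ω (ρ ω) with hf
  have hindint : Integrable (E.indicator fun _ => Real.log (1 / δ)) (P.law π μ) :=
    (integrable_const _).indicator hEm
  have hfint : Integrable f (P.law π μ) := hindint.sub hint
  -- Changing measure from `lam` back to `μ` multiplies `H` by `exp` of minus the log-likelihood
  -- ratio. The inequality `f ≤ exp f` below then bounds the mean of `f`, which is the source of the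
  -- constant `2`.
  have hexp_le : ∫⁻ ω, ENNReal.ofReal (Real.exp (f ω)) ∂(P.law π μ) ≤ 2 := by
    refine le_trans (lintegral_mono fun ω => ?_) (hchange.trans_le hbound)
    have h1 : - F.logLik μ lam ω (ρ ω) = F.logLik lam μ ω (ρ ω) := by
      simp only [ExpFamily.logLik, ← Finset.sum_neg_distrib, F.logRatio_neg]
    change ENNReal.ofReal (Real.exp (E.indicator (fun _ => Real.log (1 / δ)) ω -
      F.logLik μ lam ω (ρ ω))) ≤ _
    rw [sub_eq_add_neg, h1, Real.exp_add, ENNReal.ofReal_mul (Real.exp_pos _).le]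
    gcongr
    by_cases h : ω ∈ E
    · simp only [hH, indicator_of_mem h]
      rw [Real.exp_log (one_div_pos.2 hδ.1)]
      exact le_add_self
    · simp [hH, indicator_of_notMem h]
  have hexpint : Integrable (fun ω => Real.exp (f ω)) (P.law π μ) := by
    refine ⟨(Real.continuous_exp.comp_aestronglyMeasurable hfint.1), ?_⟩
    rw [hasFiniteIntegral_iff_ofReal (ae_of_all _ fun ω => (Real.exp_pos _).le)]
    exact hexp_le.trans_lt (by simp)
  have h1 : ∫ ω, f ω ∂(P.law π μ) ≤ 2 := by
    calc ∫ ω, f ω ∂(P.law π μ) ≤ ∫ ω, Real.exp (f ω) ∂(P.law π μ) :=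
          integral_mono hfint hexpint fun ω => by
            change f ω ≤ Real.exp (f ω)
            linarith [Real.add_one_le_exp (f ω)]
      _ ≤ 2 := by
          rw [integral_eq_lintegral_of_nonneg_ae (ae_of_all _ fun ω => (Real.exp_pos _).le)
            hexpint.1]
          exact ENNReal.toReal_le_of_le_ofReal zero_le_two (by simpa using hexp_le)
  rw [hf, integral_sub hindint hint, heq, integral_indicator_const _ hEm, smul_eq_mul] at h1
  change (P.law π μ).real E * _ - ∑ a, (∑ s ∈ Finset.range n, (P.law π μ).real
        ({ω | s < ρ ω} ∩ {ω | (ω s).1 = a})) * F.bregman (μ a) (lam a) ≤ 2 at h1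
  linarith

/-- The expected pulls `m` before the truncated time sum to `T`, at most the expected stopping time.
The transportation inequality holds for every alternative with the same `m`, so the value at `w = m
/ T` is at least `R / T`, while the complexity is at most the inverse of that value. -/
lemma ofReal_mul_complexity_le {π : SamplingRule K} {δ : ℝ} (hδ : δ ∈ Ioc (0 : ℝ) 1)
    (hcorr : P.IsCorrect π c δ) {i : Fin M} {μ : Fin K → ℝ} (hμ : μ ∈ P.cell i) (n : ℕ)
    (hK : (stdSimplex ℝ (Fin K)).Nonempty) :
    ENNReal.ofReal (Real.log (1 / δ) * (P.law π μ).real (P.stopsWith c i n) - 2) *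
      P.complexity μ ≤ P.expectedTime π c μ := by
  have hcomp : ∀ w ∈ stdSimplex ℝ (Fin K), P.complexity μ ≤ (P.value μ w)⁻¹ := fun w hw =>
    ENNReal.inv_le_inv.2 (le_iSup₂_of_le w hw le_rfl)
  -- Without alternatives the value is infinite and the complexity is zero, so there is nothing to
  -- prove.
  rcases (P.alt μ).eq_empty_or_nonempty with halt | ⟨lam₀, hlam₀⟩
  · obtain ⟨w, hw⟩ := hK
    have : P.complexity μ = 0 := by
      have h := hcomp w hw
      simpa [value, halt] using h
    rw [this, mul_zero]
    exact zero_le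
  set R := Real.log (1 / δ) * (P.law π μ).real (P.stopsWith c i n) - 2 with hR
  set m : Fin K → ℝ := fun a => ∑ s ∈ Finset.range n, (P.law π μ).real
        ({ω | s < P.truncatedTime c n ω} ∩ {ω | (ω s).1 = a}) with hmdef
  have hm0 : ∀ a, 0 ≤ m a := fun a => Finset.sum_nonneg fun s _ => measureReal_nonneg
  have hmain : ∀ lam ∈ P.alt μ, R ≤ ∑ a, m a * F.bregman (μ a) (lam a) := fun lam hlam =>
    log_mul_sub_le hδ hcorr hμ hlam
  set T := ∑ a, m a with hT
  have hT0 : 0 ≤ T := Finset.sum_nonneg fun a _ => hm0 a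
  have hTle : ENNReal.ofReal T ≤ P.expectedTime π c μ := by
    refine le_trans (le_of_eq ?_) (sum_measure_lt_stoppingTime_le (n := n) π μ)
    have h1 : T = ∑ s ∈ Finset.range n,
        (P.law π μ).real {ω | (s : ℕ∞) < P.stoppingTime c ω} := by
      rw [hT, hmdef, Finset.sum_comm]
      refine Finset.sum_congr rfl fun s hs => ?_
      have h2 : {ω | (s : ℕ∞) < P.stoppingTime c ω} =
          ⋃ a ∈ Finset.univ, ({ω | s < P.truncatedTime c n ω} ∩ {ω | (ω s).1 = a}) := by
        ext ω
        have := Finset.mem_range.1 hs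
        simp [lt_truncatedTime_iff, this]
      rw [h2, measureReal_biUnion_finset]
      · intro a _ b _ hab
        refine Set.disjoint_left.2 fun ω h1 h2 => hab ?_
        exact h1.2.symm.trans h2.2
      · exact fun a _ => (measurableSet_lt_truncatedTime s).inter (measurableSet_arm_eq s a)
    rw [h1, ENNReal.ofReal_sum_of_nonneg fun _ _ => measureReal_nonneg]
    exact Finset.sum_congr rfl fun s _ => ENNReal.ofReal_toReal (measure_ne_top _ _)
  refine le_trans ?_ hTle
  rcases hT0.eq_or_lt' with hTz | hTpos
  · have hmz : ∀ a, m a = 0 := fun a =>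
      (Finset.sum_eq_zero_iff_of_nonneg fun a _ => hm0 a).1 hTz a (Finset.mem_univ a)
    have : R ≤ 0 := by simpa [hmz] using hmain lam₀ hlam₀
    rw [ENNReal.ofReal_of_nonpos this, zero_mul]
    exact zero_le
  · set w : Fin K → ℝ := fun a => m a / T with hw
    have hwS : w ∈ stdSimplex ℝ (Fin K) :=
      ⟨fun a => div_nonneg (hm0 a) hT0, by rw [hw, ← Finset.sum_div]; exact div_self hTpos.ne'⟩
    have hval : ENNReal.ofReal (R / T) ≤ P.value μ w := by
      refine le_iInf₂ fun lam hlam => ?_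
      rw [sum_mul_d_eq hμ hlam hwS.1]
      refine ENNReal.ofReal_le_ofReal ?_
      rw [div_le_iff₀ hTpos, Finset.sum_mul]
      refine (hmain lam hlam).trans_eq (Finset.sum_congr rfl fun a _ => ?_)
      rw [hw]
      field_simp
    calc ENNReal.ofReal R * P.complexity μ
        ≤ ENNReal.ofReal R * (ENNReal.ofReal (R / T))⁻¹ := by
          gcongr
          exact (hcomp w hwS).trans (ENNReal.inv_le_inv.2 hval)
      _ ≤ ENNReal.ofReal T := by
          rw [← div_eq_mul_inv]
          refine ENNReal.div_le_of_le_mul ?_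
          rw [← ENNReal.ofReal_mul hT0, mul_div_cancel₀ _ hTpos.ne']

/-- A finite expectation makes the stopping time finite almost surely, so correctness gives
probability at least `1 - δ` to the increasing union over `n`; a further `δ` is spent on passing to
a finite `n`. -/
lemma exists_stopsWith_ge {π : SamplingRule K} {δ : ℝ} (hδ : 0 < δ)
    (hcorr : P.IsCorrect π c δ) {i : Fin M} {μ : Fin K → ℝ} (hμ : μ ∈ P.cell i)
    (hfin : P.expectedTime π c μ ≠ ∞) :
    ∃ n, 1 - 2 * δ ≤ (P.law π μ).real (P.stopsWith c i n) := by
  have htop : P.law π μ {ω | P.stoppingTime c ω = ⊤} = 0 := by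
    have h := ae_lt_top measurable_stoppingTime hfin
    refine measure_mono_null (fun ω hω => ?_) (ae_iff.1 h)
    have : P.stoppingTime c ω = ⊤ := hω
    simp [this]
  have hmono : Monotone fun n => P.stopsWith c i n := by
    rintro n n' hnn' ω ⟨h1, h2⟩
    have hle : P.stoppingTime c ω ≤ n := not_lt.1 h1
    have hle' : P.stoppingTime c ω ≤ n' := hle.trans (by exact_mod_cast hnn')
    refine ⟨not_lt.2 hle', ?_⟩
    have : P.truncatedTime c n' ω = P.truncatedTime c n ω := by
      have := (truncatedTime_eq hle').symm.trans (truncatedTime_eq hle)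
      exact_mod_cast this
    rwa [this]
  have hcover : (univ : Set (ℕ → Fin K × ℝ)) ⊆ (⋃ n, P.stopsWith c i n) ∪
      ({ω | ∃ t : ℕ, P.stoppingTime c ω = t ∧ ¬ P.Recommends ω t i} ∪
        {ω | P.stoppingTime c ω = ⊤}) := by
    intro ω _
    by_cases h : P.stoppingTime c ω = ⊤
    · exact Or.inr (Or.inr h)
    · obtain ⟨t, ht⟩ := ENat.ne_top_iff_exists.1 h
      by_cases hr : P.Recommends ω t i
      · refine Or.inl (mem_iUnion.2 ⟨t, not_lt.2 ht.ge, ?_⟩)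
        have := (truncatedTime_eq ht.ge).symm.trans ht.symm
        have h2 : P.truncatedTime c t ω = t := by exact_mod_cast this
        rwa [h2]
      · exact Or.inr (Or.inl ⟨t, ht.symm, hr⟩)
  have hge : 1 ≤ P.law π μ (⋃ n, P.stopsWith c i n) + ENNReal.ofReal δ := by
    calc (1 : ℝ≥0∞) = P.law π μ univ := measure_univ.symm
      _ ≤ _ := measure_mono hcover
      _ ≤ _ := measure_union_le _ _
      _ ≤ _ := by
        gcongr
        refine (measure_union_le _ _).trans ?_
        rw [htop, add_zero]
        exact hcorr i μ hμ
  have hge' : 1 - δ ≤ (P.law π μ).real (⋃ n, P.stopsWith c i n) := by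
    have := ENNReal.toReal_mono (by finiteness) hge
    rw [ENNReal.toReal_add (by finiteness) (by finiteness), ENNReal.toReal_one,
      ENNReal.toReal_ofReal hδ.le] at this
    change 1 ≤ (P.law π μ).real _ + δ at this
    linarith
  have htend : Tendsto (fun n => (P.law π μ).real (P.stopsWith c i n)) atTop
      (𝓝 ((P.law π μ).real (⋃ n, P.stopsWith c i n))) :=
    (ENNReal.tendsto_toReal (measure_ne_top _ _)).comp (tendsto_measure_iUnion_atTop hmono)
  obtain ⟨n, hn⟩ := (htend.eventually (lt_mem_nhds
    (show 1 - 2 * δ < (P.law π μ).real (⋃ n, P.stopsWith c i n) by linarith))).exists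
  exact ⟨n, hn.le⟩

/-- For each `δ` in `(0, 1)` the ratio is at least `(1 - 2 * δ - 2 / log (1 / δ)) * T*(μ)`,
trivially so when the expected time is infinite, and the first factor tends to one. -/
lemma complexity_le_limsup {c : ℕ → ℝ → ℝ} {π : SamplingRule K}
    (hcorr : ∀ δ ∈ Ioc (0 : ℝ) 1, P.IsCorrect π (fun t => c t δ) δ) {μ : Fin K → ℝ}
    (hμ : μ ∈ P.domain) (hK : (stdSimplex ℝ (Fin K)).Nonempty) :
    P.complexity μ ≤
    limsup (fun δ : ℝ => P.expectedTime π (fun t => c t δ) μ / ENNReal.ofReal (Real.log (1 / δ)))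
      (𝓝[>] 0) := by
  obtain ⟨i, hi⟩ := mem_iUnion.1 hμ
  have hlim : Tendsto (fun δ : ℝ => ENNReal.ofReal (1 - 2 * δ - 2 / Real.log (1 / δ)) *
      P.complexity μ) (𝓝[>] 0) (𝓝 (1 * P.complexity μ)) := by
    refine ENNReal.Tendsto.mul_const ?_ (Or.inl one_ne_zero)
    rw [← ENNReal.ofReal_one]
    refine ENNReal.tendsto_ofReal ?_
    have h1 : Tendsto (fun δ : ℝ => 1 - 2 * δ) (𝓝[>] 0) (𝓝 (1 - 2 * 0)) :=
      (Continuous.tendsto (by fun_prop) _).mono_left nhdsWithin_le_nhds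
    have h2 := h1.sub (tendsto_log_one_div.const_div_atTop 2)
    simpa using h2
  rw [one_mul] at hlim
  rw [← hlim.limsup_eq]
  refine limsup_le_limsup ?_
  filter_upwards [Ioo_mem_nhdsGT (zero_lt_one' ℝ)] with δ hδ
  have hδ' : δ ∈ Ioc (0 : ℝ) 1 := ⟨hδ.1, hδ.2.le⟩
  have hlog : 0 < Real.log (1 / δ) :=
    Real.log_pos (by rw [lt_div_iff₀ hδ.1]; linarith [hδ.2])
  rw [ENNReal.le_div_iff_mul_le (Or.inl (by simpa using hlog)) (Or.inl ENNReal.ofReal_ne_top)]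
  rcases eq_or_ne (P.expectedTime π (fun t => c t δ) μ) ∞ with htop | hfin
  · rw [htop]; exact le_top
  obtain ⟨n, hn⟩ := exists_stopsWith_ge hδ.1 (hcorr δ hδ') hi hfin
  refine le_trans ?_ (ofReal_mul_complexity_le hδ' (hcorr δ hδ') hi n hK)
  rw [mul_right_comm, ← ENNReal.ofReal_mul' hlog.le]
  gcongr
  calc (1 - 2 * δ - 2 / Real.log (1 / δ)) * Real.log (1 / δ)
      = Real.log (1 / δ) * (1 - 2 * δ) - 2 := by field_simp
    _ ≤ _ := by gcongr

end LowerBound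

end IdentificationProblem

end

theorem theorem5p3 {K M : ℕ} (F : ExpFamily) (P : IdentificationProblem F K M)
    (huniq : ∀ μ ∈ P.domain, ∃! w, P.IsOptimalWeights μ w)
    (hcont : ∀ i, ContinuousOn P.optWeights (P.cell i))
    (c : ℕ → ℝ → ℝ)
    (hmono : ∀ δ ∈ Ioc (0 : ℝ) 1, Monotone fun t => c t δ)
    (C D : ℝ) (hC : 0 < C) (hD : 0 < D)
    (hc : ∀ t : ℕ, C ≤ t → ∀ δ ∈ Ioc (0 : ℝ) 1, c t δ ≤ Real.log (D * t / δ))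
    (π : SamplingRule K) (hπ : P.IsTracking π)
    (μ : Fin K → ℝ) (hμ : μ ∈ P.domain) :
    limsup (fun δ : ℝ => P.expectedTime π (fun t => c t δ) μ / ENNReal.ofReal (Real.log (1 / δ)))
        (𝓝[>] 0) ≤ P.complexity μ ∧
    ((∀ δ ∈ Ioc (0 : ℝ) 1, P.IsCorrect π (fun t => c t δ) δ) →
      limsup (fun δ : ℝ => P.expectedTime π (fun t => c t δ) μ / ENNReal.ofReal (Real.log (1 / δ)))
        (𝓝[>] 0) = P.complexity μ) := by
  have hle := IdentificationProblem.limsup_expectedTime_le huniq hcont hD hc hπ hμ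
  refine ⟨hle, fun hcorr => le_antisymm hle ?_⟩
  exact IdentificationProblem.complexity_le_limsup hcorr hμ
    ⟨_, (IdentificationProblem.optWeights_isOptimal huniq hμ).1⟩
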